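/- Let $\Phi=\{\phi_i\}_{i\in\mathcal D}$ be a finite family of at least two maps which is a conformal iterated function system on a compact set $Y\subset\mathbb R^d$. This means that each $\phi_i:Y\to Y$ is a contraction (with some ratio $r_i\in(0,1)$) which extends to an injective $C^1$ contraction (again denoted $\phi_i$) from some open connected set $V_i\supset Y$ to $\mathbb R^d$, such that $|\phi_i'(x)y|=|\phi_i'(x)|\,|y|$ for all $x\in V_i$, $y\in\mathbb R^d$, such that $0<\inf_{V_i}|\phi_i'|\le\sup_{V_i}|\phi_i'|<1$, and such that for some $\alpha_i,c_i>0$ one has $\big||\phi_i'(x)|-|\phi_i'(y)|\big|\le c_i|x-y|^{\alpha_i}$ for all $x,y\in V_i$. Let $X\subset Y$ be the attractor, i.e. the unique non-empty compact set with $X=\bigcup_{i\in\mathcal D}\phi_i(X)$, and suppose that the strong separation condition holds: $\phi_i(X)\cap\phi_j(X)=\emptyset$ for $i\ne j$. Let $z\in X$ and let $\theta:\mathbb N=\{1,2,\dots\}\to\mathbb R_{\ge0}$ (not assumed monotone) satisfy $\theta(n)\asymp n^{-1/\dim_H(X)}$, i.e. there is $C>0$ with $C^{-1}\theta(n)\le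 n^{-1/\dim_H(X)}\le C\,\theta(n)$ for all $n\ge1$. For a word $I=(i_1,\dots,i_n)\in\mathcal D^*=\bigcup_{n\ge1}\mathcal D^n$ write $|I|=n$, $\phi_I=\phi_{i_1}\circ\cdots\circ\phi_{i_n}$ and $X_I=\phi_I(X)$, let $B(x,r)$ denote the closed ball, and put $$W(\theta,z)=\Big\{x\in X:\ x\in B\big(\phi_I(z),\,\mathrm{Diam}(X_I)\,\theta(|I|)\big)\text{ for infinitely many } I\in\mathcal D^*\Big\}.$$ Then $\mathcal H^{\dim_H(X)}$-almost every $x\in X$ is an element of $W(\theta,z)$. -/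

import Mathlib

open Set MeasureTheory Metric
open scoped NNReal

namespace SelfConformal

/-- `f` contracts distances on `S` by a uniform factor `r` in `(0,1)`. -/
def IsContractionOn {E : Type*} [PseudoMetricSpace E] (f : E → E) (S : Set E) : Prop :=
  ∃ r ∈ Ioo (0 : ℝ) 1, ∀ x ∈ S, ∀ y ∈ S, dist (f x) (f y) ≤ r * dist x y

/-- The maps `φ i` form an iterated function system on the set `Y`: each of them is a contraction
of `Y` into itself (only the values on `Y` matter). -/
structure IsIFS {E ι : Type*} [PseudoMetricSpace E] (φ : ι → E → E) (Y : Set E) : Prop where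
  mapsTo : ∀ i, MapsTo (φ i) Y Y
  contraction : ∀ i, IsContractionOn (φ i) Y

/-- `ψ` is, on the open set `V`, a conformal mapping of class `C¹`: its differential
multiplies all lengths by the same factor. -/
structure IsConformalOn {d : ℕ} (ψ : EuclideanSpace ℝ (Fin d) → EuclideanSpace ℝ (Fin d))
    (V : Set (EuclideanSpace ℝ (Fin d))) : Prop where
  contDiffOn : ContDiffOn ℝ 1 ψ V
  norm_fderiv_apply : ∀ x ∈ V, ∀ y, ‖fderiv ℝ ψ x y‖ = ‖fderiv ℝ ψ x‖ * ‖y‖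

/-- `ψ` is an injective conformal contraction on `V` for which the norm of the differential is
bounded away from `0` and from `1` and is Hölder continuous on `V`. -/
structure IsConformalContractionOn {d : ℕ}
    (ψ : EuclideanSpace ℝ (Fin d) → EuclideanSpace ℝ (Fin d))
    (V : Set (EuclideanSpace ℝ (Fin d))) : Prop where
  conformal : IsConformalOn ψ V
  injOn : InjOn ψ V
  contraction : IsContractionOn ψ V
  lower_bound : ∃ a : ℝ, 0 < a ∧ ∀ x ∈ V, a ≤ ‖fderiv ℝ ψ x‖
  upper_bound : ∃ b : ℝ, b < 1 ∧ ∀ x ∈ V, ‖fderiv ℝ ψ x‖ ≤ b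
  holder : ∃ α : ℝ, 0 < α ∧ ∃ c : ℝ, 0 < c ∧ ∀ x ∈ V, ∀ y ∈ V,
    |‖fderiv ℝ ψ x‖ - ‖fderiv ℝ ψ y‖| ≤ c * ‖x - y‖ ^ α

/-- A conformal iterated function system on the compact set `Y`: each `φ i` agrees on `Y` with an
injective conformal contraction of some open connected neighbourhood of `Y`. -/
structure IsConformalIFS {d : ℕ} {ι : Type*}
    (φ : ι → EuclideanSpace ℝ (Fin d) → EuclideanSpace ℝ (Fin d))
    (Y : Set (EuclideanSpace ℝ (Fin d))) : Prop where
  isCompact : IsCompact Y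
  isIFS : IsIFS φ Y
  extension : ∀ i, ∃ V : Set (EuclideanSpace ℝ (Fin d)), IsOpen V ∧ IsConnected V ∧ Y ⊆ V ∧
    ∃ ψ : EuclideanSpace ℝ (Fin d) → EuclideanSpace ℝ (Fin d),
      EqOn ψ (φ i) Y ∧ IsConformalContractionOn ψ V

/-- `X` is the attractor of the system `φ` on `Y`. -/
structure IsAttractor {E ι : Type*} [PseudoMetricSpace E] (φ : ι → E → E) (Y X : Set E) :
    Prop where
  nonempty : X.Nonempty
  isCompact : IsCompact X
  subset : X ⊆ Y
  eq_iUnion : X = ⋃ i, φ i '' X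

/-- The strong separation condition for a system `φ` with attractor `X`. -/
def StrongSeparation {E ι : Type*} (φ : ι → E → E) (X : Set E) : Prop :=
  ∀ i j, i ≠ j → Disjoint (φ i '' X) (φ j '' X)

/-- `wordMap φ [i₁, …, iₙ] = φ i₁ ∘ ⋯ ∘ φ iₙ`. -/
def wordMap {E ι : Type*} (φ : ι → E → E) : List ι → E → E
  | [] => id
  | i :: I => φ i ∘ wordMap φ I

/-- The points `x` of `X` that lie in the closed ball of radius `Ψ I` around `wordMap φ I z` for
infinitely many non-empty finite words `I`. -/
def limsupSet {E ι : Type*} [PseudoMetricSpace E] (φ : ι → E → E) (X : Set E)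
    (Ψ : List ι → ℝ) (z : E) : Set E :=
  {x ∈ X | {I : List ι | I ≠ [] ∧ x ∈ closedBall (wordMap φ I z) (Ψ I)}.Infinite}

/-- The set `W(θ, z)`: the approximating function is `I ↦ Diam(X_I) θ(|I|)`, where
`X_I` is the image of `X` under `wordMap φ I`. -/
noncomputable def W {E ι : Type*} [PseudoMetricSpace E] (φ : ι → E → E) (X : Set E)
    (θ : ℕ → ℝ≥0) (z : E) : Set E :=
  limsupSet φ X (fun I => diam (wordMap φ I '' X) * (θ I.length : ℝ)) z

/-- `f ≍ g` on `S`: the two functions are comparable up to a positive multiplicative constant. -/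
def AsympOn {S : Type*} (s : Set S) (f g : S → ℝ) : Prop :=
  ∃ C : ℝ, 0 < C ∧ ∀ n ∈ s, C⁻¹ * f n ≤ g n ∧ g n ≤ C * f n

end SelfConformal

open SelfConformal

open scoped ENNReal
open Filter Topology

namespace SelfConformal

/-! ### Words and systems of blocks -/

section Words

variable {E ι : Type*}

/-! Bounded distortion makes every composition `wordMap f I` a similarity of ratio `ℓ I` up to one
constant `K` (`IsConformalIFS.exists_isQuasiSelfSimilar`); from then on only `IsQuasiSelfSimilar`
matters.

Let s be the dimension of X. If the sum of `ℓ I ^ s` over words of some length n exceeded `(K ^ 3) ^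
s`, the same strict inequality would hold for some t > s, and a mass distribution argument for the
n-fold compositions (`hausdorffMeasure_ne_zero`) would give positive t-measure, which is absurd. So
the level sums are bounded uniformly in n, and covering X by its cylinders of level n shows that its
s-measure is finite. Its positivity is not needed.

The measure is quasi-Bernoulli (`measureReal_append`): inside each cylinder, the points that
continue with J have proportion at least a constant times `ℓ J ^ s`. Choose times n_k of order k log
k and initial words J_k of a coding of z with `ℓ J_k` of order n_k ^ (-1/s). If I is the word of the
first n_k letters of x and J_k follows it, then x is close enough to `wordMap f I z`. Since J_k has
length O(log k), the windows occupied by the J_k do not overlap, while the proportions, of order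
1/n_k, have divergent sum. A Borel–Cantelli argument (`ae_frequently_mem_wordAt`) then gives
infinitely many hits almost everywhere. Only lower bounds for θ at the times n_k enter, so θ need
not be monotone. -/

lemma wordMap_append (f : ι → E → E) (I J : List ι) (x : E) :
    wordMap f (I ++ J) x = wordMap f I (wordMap f J x) := by
  induction I with
  | nil => rfl
  | cons i I ih => simp only [List.cons_append, wordMap, Function.comp_apply, ih]

lemma wordMap_append_image (f : ι → E → E) (I J : List ι) (X : Set E) :
    wordMap f (I ++ J) '' X = wordMap f I '' (wordMap f J '' X) := by
  rw [image_image]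
  exact image_congr fun x _ => wordMap_append f I J x

/-- The system of all compositions of `n` maps of `f`. -/
def blockMap (f : ι → E → E) (n : ℕ) (b : List.Vector ι n) : E → E := wordMap f b.1

/-- The word over `ι` spelled by a word of blocks. -/
def flattenBlocks {n : ℕ} (L : List (List.Vector ι n)) : List ι := (L.map Subtype.val).flatten

lemma wordMap_blockMap (f : ι → E → E) (n : ℕ) (L : List (List.Vector ι n)) (x : E) :
    wordMap (blockMap f n) L x = wordMap f (flattenBlocks L) x := by
  induction L with
  | nil => rfl
  | cons b L ih =>
    have : flattenBlocks (b :: L) = b.1 ++ flattenBlocks L := rfl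
    rw [this, wordMap_append, ← ih]
    rfl

end Words

/-- A system of contractions on its attractor `X`, with strong separation, all of whose compositions
`wordMap f I` are similarities of ratio `ℓ I` up to a factor `K`. -/
structure IsQuasiSelfSimilar {E ι : Type*} [MetricSpace E] (f : ι → E → E) (X : Set E)
    (ℓ : List ι → ℝ) (K r : ℝ) : Prop where
  nontrivial : X.Nontrivial
  isCompact : IsCompact X
  eq_iUnion : X = ⋃ i, f i '' X
  separation : StrongSeparation f X
  one_le : 1 ≤ K
  pos : ∀ I, 0 < ℓ I
  ratio_pos : 0 < r
  ratio_lt_one : r < 1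
  contraction : ∀ i, ∀ x ∈ X, ∀ y ∈ X, dist (f i x) (f i y) ≤ r * dist x y
  lower : ∀ I, ∀ x ∈ X, ∀ y ∈ X, ℓ I * dist x y ≤ K * dist (wordMap f I x) (wordMap f I y)
  upper : ∀ I, ∀ x ∈ X, ∀ y ∈ X, dist (wordMap f I x) (wordMap f I y) ≤ K * ℓ I * dist x y

/-! ### Cylinders of a quasi self-similar system -/

namespace IsQuasiSelfSimilar

variable {E ι : Type*} [MetricSpace E] {f : ι → E → E} {X : Set E} {ℓ : List ι → ℝ} {K r : ℝ}

section Basic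

variable (h : IsQuasiSelfSimilar f X ℓ K r)
include h

lemma K_pos : 0 < K := zero_lt_one.trans_le h.one_le

lemma mapsTo (i : ι) : MapsTo (f i) X X := fun x hx => by
  rw [h.eq_iUnion]
  exact mem_iUnion.2 ⟨i, mem_image_of_mem _ hx⟩

lemma mapsTo_wordMap (I : List ι) : MapsTo (wordMap f I) X X := by
  induction I with
  | nil => exact mapsTo_id X
  | cons i I ih => exact (h.mapsTo i).comp ih

lemma image_subset (I : List ι) : wordMap f I '' X ⊆ X := (h.mapsTo_wordMap I).image_subset

lemma image_append_subset (I J : List ι) : wordMap f (I ++ J) '' X ⊆ wordMap f I '' X := by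
  rw [wordMap_append_image]
  exact image_mono (h.image_subset J)

lemma injOn (I : List ι) : InjOn (wordMap f I) X := by
  intro x hx y hy hxy
  have := h.lower I x hx y hy
  rw [hxy, dist_self, mul_zero] at this
  have h2 := h.pos I
  exact dist_le_zero.1 (nonpos_of_mul_nonpos_right this h2)

lemma dist_wordMap_le (I : List ι) {x y : E} (hx : x ∈ X) (hy : y ∈ X) :
    dist (wordMap f I x) (wordMap f I y) ≤ r ^ I.length * dist x y := by
  induction I with
  | nil => simp [wordMap]
  | cons i I ih =>
    calc _ ≤ r * dist (wordMap f I x) (wordMap f I y) :=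
          h.contraction i _ (h.mapsTo_wordMap I hx) _ (h.mapsTo_wordMap I hy)
      _ ≤ r * (r ^ I.length * dist x y) := by gcongr; exact h.ratio_pos.le
      _ = _ := by rw [List.length_cons, pow_succ]; ring

lemma lipschitzOnWith (I : List ι) :
    LipschitzOnWith (Real.toNNReal (K * ℓ I)) (wordMap f I) X := by
  refine LipschitzOnWith.of_dist_le_mul fun x hx y hy => ?_
  rw [Real.coe_toNNReal _ (mul_pos h.K_pos (h.pos I)).le]
  exact h.upper I x hx y hy

lemma isCompact_image (I : List ι) : IsCompact (wordMap f I '' X) :=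
  h.isCompact.image_of_continuousOn (h.lipschitzOnWith I).continuousOn

lemma exists_wordMap_eq (n : ℕ) {x : E} (hx : x ∈ X) :
    ∃ I : List ι, I.length = n ∧ x ∈ wordMap f I '' X := by
  induction n generalizing x with
  | zero => exact ⟨[], rfl, by simpa [wordMap] using hx⟩
  | succ n ih =>
    have hx' := hx
    rw [h.eq_iUnion] at hx'
    obtain ⟨i, y, hy, rfl⟩ := mem_iUnion.1 hx'
    obtain ⟨I, hI, w, hw, rfl⟩ := ih hy
    exact ⟨i :: I, by simp [hI], w, hw, rfl⟩

lemma eq_of_mem_of_mem {I J : List ι} (hIJ : I.length = J.length) {x : E}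
    (hI : x ∈ wordMap f I '' X) (hJ : x ∈ wordMap f J '' X) : I = J := by
  induction I generalizing J x with
  | nil => exact (List.length_eq_zero_iff.1 hIJ.symm).symm
  | cons i I ih =>
    obtain _ | ⟨j, J⟩ := J
    · simp at hIJ
    obtain ⟨u, hu, rfl⟩ := hI
    obtain ⟨v, hv, huv⟩ := hJ
    have hu' := h.mapsTo_wordMap I hu
    have hv' := h.mapsTo_wordMap J hv
    have hij : i = j := by
      by_contra hne
      refine disjoint_left.1 (h.separation i j hne) (mem_image_of_mem _ hu') ?_
      exact ⟨_, hv', huv⟩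
    subst hij
    have := h.injOn [i] hv' hu' huv
    congr 1
    exact ih (by simpa using hIJ) (mem_image_of_mem _ hu) ⟨v, hv, this⟩

/-- Tested on one pair of distinct points: each lower bound, for J and for I, costs a factor `K`,
and so does the upper bound for the concatenation. -/
lemma mul_le (I J : List ι) : ℓ I * ℓ J ≤ K ^ 3 * ℓ (I ++ J) := by
  obtain ⟨x, hx, y, hy, hne⟩ := h.nontrivial
  have hd := dist_pos.2 hne
  have h1 := h.lower J x hx y hy
  have h2 := h.lower I _ (h.mapsTo_wordMap J hx) _ (h.mapsTo_wordMap J hy)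
  have h3 := h.upper (I ++ J) x hx y hy
  rw [wordMap_append, wordMap_append] at h3
  refine le_of_mul_le_mul_right ?_ hd
  calc ℓ I * ℓ J * dist x y = ℓ I * (ℓ J * dist x y) := by ring
    _ ≤ ℓ I * (K * dist (wordMap f J x) (wordMap f J y)) := by gcongr; exact (h.pos I).le
    _ = K * (ℓ I * dist (wordMap f J x) (wordMap f J y)) := by ring
    _ ≤ K * (K * (K * ℓ (I ++ J) * dist x y)) := by
        refine mul_le_mul_of_nonneg_left (h2.trans ?_) h.K_pos.le
        exact mul_le_mul_of_nonneg_left h3 h.K_pos.le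
    _ = _ := by ring

lemma ratio_le (I : List ι) : ℓ I ≤ K * r ^ I.length := by
  obtain ⟨x, hx, y, hy, hne⟩ := h.nontrivial
  refine le_of_mul_le_mul_right ?_ (dist_pos.2 hne)
  calc _ ≤ K * dist (wordMap f I x) (wordMap f I y) := h.lower I x hx y hy
    _ ≤ K * (r ^ I.length * dist x y) :=
        mul_le_mul_of_nonneg_left (h.dist_wordMap_le I hx hy) h.K_pos.le
    _ = _ := by ring

lemma one_le_mul_ratio_nil : 1 ≤ K * ℓ [] := by
  obtain ⟨x, hx, y, hy, hne⟩ := h.nontrivial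
  refine le_of_mul_le_mul_right ?_ (dist_pos.2 hne)
  simpa [wordMap] using h.upper [] x hx y hy

lemma diam_image_le (I : List ι) : diam (wordMap f I '' X) ≤ K * ℓ I * diam X := by
  refine diam_le_of_forall_dist_le
    (mul_nonneg (mul_pos h.K_pos (h.pos I)).le diam_nonneg) ?_
  rintro _ ⟨x, hx, rfl⟩ _ ⟨y, hy, rfl⟩
  refine (h.upper I x hx y hy).trans ?_
  have := (mul_pos h.K_pos (h.pos I)).le
  gcongr
  exact dist_le_diam_of_mem h.isCompact.isBounded hx hy

lemma diam_image_le_pow (I : List ι) : diam (wordMap f I '' X) ≤ r ^ I.length * diam X := by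
  have h0 := pow_nonneg h.ratio_pos.le I.length
  refine diam_le_of_forall_dist_le (mul_nonneg h0 diam_nonneg) ?_
  rintro _ ⟨x, hx, rfl⟩ _ ⟨y, hy, rfl⟩
  refine (h.dist_wordMap_le I hx hy).trans ?_
  gcongr
  exact dist_le_diam_of_mem h.isCompact.isBounded hx hy

lemma le_diam_image (I : List ι) : ℓ I * diam X ≤ K * diam (wordMap f I '' X) := by
  have h1 : diam X ≤ K * diam (wordMap f I '' X) / ℓ I := by
    refine diam_le_of_forall_dist_le
      (div_nonneg (mul_nonneg h.K_pos.le diam_nonneg) (h.pos I).le) fun x hx y hy => ?_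
    rw [le_div_iff₀ (h.pos I), mul_comm]
    refine (h.lower I x hx y hy).trans (mul_le_mul_of_nonneg_left ?_ h.K_pos.le)
    exact dist_le_diam_of_mem (h.isCompact_image I).isBounded
      (mem_image_of_mem _ hx) (mem_image_of_mem _ hy)
  rw [le_div_iff₀ (h.pos I)] at h1
  linarith

lemma ediam_image_le (I : List ι) :
    ediam (wordMap f I '' X) ≤ ENNReal.ofReal (K * ℓ I) * ediam X :=
  ediam_le fun _ ⟨x, hx, hx'⟩ _ ⟨y, hy, hy'⟩ => by
    rw [← hx', ← hy']
    refine (h.lipschitzOnWith I hx hy).trans ?_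
    exact mul_le_mul_right (edist_le_ediam_of_mem hx hy) _

/-- The point is that `K` does not depend on n, so bounds for one-letter sums of block systems are
uniform in the level. -/
lemma block {n : ℕ} (hn : 1 ≤ n) :
    IsQuasiSelfSimilar (blockMap f n) X (fun L => ℓ (flattenBlocks L)) K r where
  nontrivial := h.nontrivial
  isCompact := h.isCompact
  eq_iUnion := by
    ext x
    rw [mem_iUnion]
    constructor
    · intro hx
      obtain ⟨I, hI, hx⟩ := h.exists_wordMap_eq n hx
      exact ⟨⟨I, hI⟩, hx⟩
    · rintro ⟨b, hb⟩
      exact h.image_subset b.1 hb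
  separation := fun a b hab => disjoint_left.2 fun x ha hb =>
    hab (Subtype.ext (h.eq_of_mem_of_mem (a.2.trans b.2.symm) ha hb))
  one_le := h.one_le
  pos := fun L => h.pos _
  ratio_pos := h.ratio_pos
  ratio_lt_one := h.ratio_lt_one
  contraction := fun b x hx y hy => by
    refine (h.dist_wordMap_le b.1 hx hy).trans ?_
    gcongr
    rw [b.2]
    exact pow_le_of_le_one h.ratio_pos.le h.ratio_lt_one.le (by omega)
  lower := fun L x hx y hy => by
    rw [wordMap_blockMap, wordMap_blockMap]
    exact h.lower _ x hx y hy
  upper := fun L x hx y hy => by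
    rw [wordMap_blockMap, wordMap_blockMap]
    exact h.upper _ x hx y hy

end Basic

end IsQuasiSelfSimilar


/-- A weight on words that does not decrease when a word is replaced by all its one-letter
extensions is bounded by its total mass on any finite family of words cutting all long words. -/
lemma le_sum_of_forall_exists_prefix {β : Type*} [Fintype β] (n : ℕ) (v : List β → ℝ≥0∞)
    (hv : ∀ I, v I ≤ ∑ b, v (I ++ [b])) (F : Finset (List β))
    (hF : ∀ J : List β, J.length = n → ∃ I ∈ F, I <+: J) : v [] ≤ ∑ I ∈ F, v I := by
  classical
  induction n generalizing v F with
  | zero =>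
    obtain ⟨I, hI, hp⟩ := hF [] rfl
    rw [List.prefix_nil] at hp
    subst hp
    exact Finset.single_le_sum (f := v) (fun _ _ => zero_le) hI
  | succ n ih =>
    by_cases hnil : [] ∈ F
    · exact Finset.single_le_sum (f := v) (fun _ _ => zero_le) hnil
    -- Split the family by first letter and apply induction to the tails in each subtree.
    have hinj : ∀ b : β, Function.Injective (List.cons b) := fun b => List.cons_injective
    let G : β → Finset (List β) := fun b => F.preimage (List.cons b) (hinj b).injOn
    have key : ∀ b, v [b] ≤ ∑ I ∈ G b, v (b :: I) := fun b => by
      refine ih (fun I => v (b :: I)) (fun I => hv (b :: I)) (G b) fun J hJ => ?_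
      obtain ⟨I, hI, hp⟩ := hF (b :: J) (by simp [hJ])
      obtain _ | ⟨c, I⟩ := I
      · exact absurd hI hnil
      · obtain ⟨rfl, hp'⟩ := List.cons_prefix_cons.1 hp
        exact ⟨I, Finset.mem_preimage.2 hI, hp'⟩
    calc v [] ≤ ∑ b, v [b] := hv []
      _ ≤ ∑ b, ∑ I ∈ G b, v (b :: I) := Finset.sum_le_sum fun b _ => key b
      _ = ∑ p ∈ Finset.univ.sigma G, v (p.1 :: p.2) := by rw [Finset.sum_sigma']
      _ = ∑ I ∈ (Finset.univ.sigma G).image (fun p => p.1 :: p.2), v I := by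
          rw [Finset.sum_image]
          rintro ⟨a, I⟩ _ ⟨b, J⟩ _ hab
          simp only [List.cons.injEq] at hab
          obtain ⟨rfl, rfl⟩ := hab
          rfl
      _ ≤ ∑ I ∈ F, v I := by
          refine Finset.sum_le_sum_of_subset ?_
          intro I hI
          obtain ⟨⟨b, J⟩, hJ, rfl⟩ := Finset.mem_image.1 hI
          exact Finset.mem_preimage.1 (Finset.mem_sigma.1 hJ).2

namespace IsQuasiSelfSimilar

variable {E ι : Type*} [MetricSpace E] {f : ι → E → E} {X : Set E} {ℓ : List ι → ℝ} {K r : ℝ}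

/-! ### Mass distribution and positive Hausdorff measure -/

section Cylinders

variable [Finite ι] (h : IsQuasiSelfSimilar f X ℓ K r)
include h

lemma exists_gap : ∃ δ : ℝ, 0 < δ ∧ ∀ i j, i ≠ j → ∀ x ∈ f i '' X, ∀ y ∈ f j '' X,
    δ ≤ dist x y := by
  have H : ∀ p : ι × ι, ∃ δ : ℝ, 0 < δ ∧ (p.1 ≠ p.2 → ∀ x ∈ f p.1 '' X, ∀ y ∈ f p.2 '' X,
      δ ≤ dist x y) := by
    rintro ⟨i, j⟩
    by_cases hij : i = j
    · exact ⟨1, one_pos, fun hne => absurd hij hne⟩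
    obtain ⟨δ, hδ, H⟩ := Metric.exists_pos_forall_lt_edist (h.isCompact_image [i])
      (h.isCompact_image [j]).isClosed (h.separation i j hij)
    refine ⟨δ, hδ, fun _ x hx y hy => ?_⟩
    have := (H x hx y hy).le
    rw [edist_nndist] at this
    exact_mod_cast this
  choose δ hδ H using H
  obtain ⟨x, hx⟩ := h.nontrivial.nonempty
  rw [h.eq_iUnion] at hx
  obtain ⟨i, _⟩ := mem_iUnion.1 hx
  have : Nonempty (ι × ι) := ⟨(i, i)⟩
  obtain ⟨p, hp⟩ := Finite.exists_min δ
  exact ⟨δ p, hδ p, fun i j hij x hx y hy => (hp (i, j)).trans (H (i, j) hij x hx y hy)⟩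

/-- Cylinders are relatively open, the complement being a finite union of compact cylinders of the
same level. This allows compactness to be used on covers by cylinders. -/
lemma exists_isOpen_inter_subset (I : List ι) :
    ∃ O : Set E, IsOpen O ∧ wordMap f I '' X ⊆ O ∧ O ∩ X ⊆ wordMap f I '' X := by
  have : Fintype ι := Fintype.ofFinite ι
  refine ⟨(⋃ J : {J : List.Vector ι I.length // J.1 ≠ I}, wordMap f J.1.1 '' X)ᶜ, ?_, ?_, ?_⟩
  · refine (isClosed_iUnion_of_finite fun J => ?_).isOpen_compl
    exact (h.isCompact_image J.1.1).isClosed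
  · intro x hx hx'
    obtain ⟨J, hJ⟩ := mem_iUnion.1 hx'
    exact J.2 (h.eq_of_mem_of_mem J.1.2 hJ hx)
  · rintro x ⟨hx, hxX⟩
    obtain ⟨J, hJ, hxJ⟩ := h.exists_wordMap_eq I.length hxX
    by_cases hJI : J = I
    · rwa [← hJI]
    · exact absurd (mem_iUnion.2 ⟨⟨⟨J, hJ⟩, hJI⟩, hxJ⟩) hx

/-- A subset of `X` lies in a cylinder of comparable diameter, or in arbitrarily small cylinders. -/
lemma exists_cylinder : ∃ C : ℝ, 0 < C ∧ ∀ S ⊆ X,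
    (∃ I, S ⊆ wordMap f I '' X ∧ ℓ I ≤ C * diam S) ∨
      ∀ η > 0, ∃ I, S ⊆ wordMap f I '' X ∧ ℓ I ≤ η := by
  obtain ⟨δ, hδ, hgap⟩ := h.exists_gap
  refine ⟨K / δ, div_pos h.K_pos hδ, fun S hS => ?_⟩
  by_cases hlong : ∀ n : ℕ, ∃ I : List ι, n ≤ I.length ∧ S ⊆ wordMap f I '' X
  · right
    intro η hη
    obtain ⟨n, hn⟩ := exists_pow_lt_of_lt_one (div_pos hη h.K_pos) h.ratio_lt_one
    obtain ⟨I, hI, hSI⟩ := hlong n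
    refine ⟨I, hSI, (h.ratio_le I).trans ?_⟩
    rw [lt_div_iff₀ h.K_pos] at hn
    have := pow_le_pow_of_le_one h.ratio_pos.le h.ratio_lt_one.le hI
    nlinarith [h.K_pos]
  · left
    push Not at hlong
    classical
    -- At the least such n, no cylinder of level at least n contains S, but some I of length at
    -- least n - 1 does. So S meets two different children of I, whose points come from points at
    -- distance at least δ; the lower distortion bound turns this into a bound on `ℓ I`.
    have hn := Nat.find_spec hlong
    have hmin := fun k => Nat.find_min hlong (m := k)
    set n := Nat.find hlong
    have hn0 : n ≠ 0 := by
      intro h0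
      exact hn [] (by simp [h0]) (by simpa [wordMap] using hS)
    have := hmin (n - 1) (by omega)
    push Not at this
    obtain ⟨I, hIn, hSI⟩ := this
    refine ⟨I, hSI, ?_⟩
    have hne : ∀ i, ∃ x ∈ S, x ∉ wordMap f (I ++ [i]) '' X := fun i =>
      not_subset.1 (hn (I ++ [i]) (by simp; omega))
    have hmem : ∀ x ∈ S, ∃ i, ∃ u ∈ f i '' X, wordMap f I u = x := fun x hx => by
      obtain ⟨u, hu, rfl⟩ := hSI hx
      rw [h.eq_iUnion] at hu
      obtain ⟨i, hi⟩ := mem_iUnion.1 hu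
      exact ⟨i, u, hi, rfl⟩
    have hSne : S.Nonempty := by
      by_contra hemp
      rw [not_nonempty_iff_eq_empty] at hemp
      obtain ⟨x, hx⟩ := h.nontrivial.nonempty
      obtain ⟨J, hJ, _⟩ := h.exists_wordMap_eq n hx
      exact hn J hJ.ge (by simp [hemp])
    obtain ⟨x, hx⟩ := hSne
    obtain ⟨i, u, hu, rfl⟩ := hmem x hx
    obtain ⟨y, hy, hyi⟩ := hne i
    obtain ⟨j, v, hv, rfl⟩ := hmem y hy
    have hij : i ≠ j := by
      rintro rfl
      apply hyi
      rw [wordMap_append_image]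
      exact mem_image_of_mem _ hv
    have h1 := hgap i j hij u hu v hv
    have h2 := h.lower I u (h.image_subset [i] hu) v (h.image_subset [j] hv)
    have h3 := dist_le_diam_of_mem (h.isCompact.isBounded.subset hS) hx hy
    rw [div_mul_eq_mul_div, le_div_iff₀ hδ]
    have h4 := h.pos I
    have h5 := h.K_pos
    nlinarith

end Cylinders

/-- If the one-letter weights have large enough total mass in exponent `t`, then `X` has positive
`t`-dimensional measure. -/
lemma hausdorffMeasure_ne_zero [Fintype ι] [MeasurableSpace E] [BorelSpace E]
    (h : IsQuasiSelfSimilar f X ℓ K r) {t : ℝ} (ht : 0 < t)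
    (hsum : (K ^ 3) ^ t ≤ ∑ i, ℓ [i] ^ t) : μH[t] X ≠ 0 := by
  classical
  have hKt : 0 < (K ^ 3) ^ t := Real.rpow_pos_of_pos (pow_pos h.K_pos 3) t
  let w : List ι → ℝ≥0∞ := fun I => ENNReal.ofReal (ℓ I ^ t)
  -- The factor `(K ^ 3) ^ t` lost in `mul_le` is what the hypothesis on the one-letter sum
  -- compensates.
  have hw : ∀ I, w I ≤ ∑ i, w (I ++ [i]) := by
    intro I
    have hI := Real.rpow_pos_of_pos (h.pos I) t
    rw [← ENNReal.ofReal_sum_of_nonneg fun i _ => (Real.rpow_pos_of_pos (h.pos _) t).le]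
    refine ENNReal.ofReal_le_ofReal (le_of_mul_le_mul_left ?_ hKt)
    calc (K ^ 3) ^ t * ℓ I ^ t ≤ (∑ i, ℓ [i] ^ t) * ℓ I ^ t := by gcongr
      _ = ∑ i, ℓ I ^ t * ℓ [i] ^ t := by rw [Finset.sum_mul]; simp only [mul_comm]
      _ ≤ ∑ i, (K ^ 3) ^ t * ℓ (I ++ [i]) ^ t := by
          refine Finset.sum_le_sum fun i _ => ?_
          rw [← Real.mul_rpow (h.pos _).le (h.pos _).le,
            ← Real.mul_rpow (pow_pos h.K_pos 3).le (h.pos _).le]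
          exact Real.rpow_le_rpow (mul_pos (h.pos _) (h.pos _)).le (h.mul_le I [i]) ht.le
      _ = _ := by rw [Finset.mul_sum]
  let m : Set E → ℝ≥0∞ := fun S => ⨅ (I : List ι) (_ : S ∩ X ⊆ wordMap f I '' X), w I
  have hm_le : ∀ S I, S ∩ X ⊆ wordMap f I '' X → m S ≤ w I := fun S I hI => iInf₂_le I hI
  obtain ⟨C, hC, hcyl⟩ := h.exists_cylinder
  have hm_diam : ∀ S, m S ≤ ENNReal.ofReal (C ^ t) * ediam S ^ t := by
    intro S
    have hb : Bornology.IsBounded (S ∩ X) := h.isCompact.isBounded.subset inter_subset_right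
    rcases hcyl (S ∩ X) inter_subset_right with ⟨I, hI, hle⟩ | hsmall
    · calc m S ≤ w I := hm_le S I hI
        _ ≤ ENNReal.ofReal ((C * diam (S ∩ X)) ^ t) :=
            ENNReal.ofReal_le_ofReal (Real.rpow_le_rpow (h.pos I).le hle ht.le)
        _ = ENNReal.ofReal (C ^ t) * ediam (S ∩ X) ^ t := by
            rw [Real.mul_rpow hC.le diam_nonneg,
              ENNReal.ofReal_mul (Real.rpow_nonneg hC.le t),
              ← ENNReal.ofReal_rpow_of_nonneg diam_nonneg ht.le, diam,
              ENNReal.ofReal_toReal hb.ediam_ne_top]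
        _ ≤ _ := by
            gcongr
            exact inter_subset_left
    · have : m S = 0 := by
        refine le_antisymm (le_of_forall_gt fun a ha => ?_) (zero_le)
        obtain ⟨b, hb0, hba⟩ := ENNReal.lt_iff_exists_real_btwn.1 ha
        obtain ⟨hb1, hb2⟩ := hba
        have hbpos : 0 < b := by simpa using hb1
        obtain ⟨I, hI, hle⟩ := hsmall (b ^ t⁻¹) (Real.rpow_pos_of_pos hbpos _)
        refine lt_of_le_of_lt ((hm_le S I hI).trans ?_) hb2
        refine ENNReal.ofReal_le_ofReal ?_
        calc ℓ I ^ t ≤ (b ^ t⁻¹) ^ t := Real.rpow_le_rpow (h.pos I).le hle ht.le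
          _ = b := Real.rpow_inv_rpow hbpos.le ht.ne'
      rw [this]
      exact zero_le
  have hm0 : m ∅ = 0 := by
    have := hm_diam ∅
    simpa [ENNReal.zero_rpow_of_pos ht] using this
  -- The infima defining `m` need not be attained, so each set of a countable cover is replaced by a
  -- cylinder at cost `ε' k`. Compactness leaves finitely many cylinders, and the tree inequality
  -- bounds their weights below.
  have hcover : w [] ≤ OuterMeasure.ofFunction m hm0 X := by
    rw [OuterMeasure.ofFunction_apply]
    refine le_iInf₂ fun S hS => ?_
    refine ENNReal.le_of_forall_pos_le_add fun ε hε _ => ?_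
    obtain ⟨ε', hε', hsumε⟩ :=
      ENNReal.exists_pos_sum_of_countable' (ENNReal.coe_pos.2 hε).ne' ℕ
    have hI : ∀ k, ∃ I, S k ∩ X ⊆ wordMap f I '' X ∧ w I ≤ m (S k) + ε' k := by
      intro k
      have hfin : m (S k) ≠ ∞ := ne_top_of_le_ne_top ENNReal.ofReal_ne_top
        (hm_le (S k) [] (by simp [wordMap]))
      have hlt : m (S k) < m (S k) + ε' k := ENNReal.lt_add_right hfin (hε' k).ne'
      obtain ⟨I, hI⟩ := iInf_lt_iff.1 hlt
      obtain ⟨hI1, hI2⟩ := iInf_lt_iff.1 hI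
      exact ⟨I, hI1, hI2.le⟩
    choose I hI hIw using hI
    choose O hO hXO hOX using fun k => h.exists_isOpen_inter_subset (I k)
    obtain ⟨T, hT⟩ := h.isCompact.elim_finite_subcover O hO fun x hx => by
      obtain ⟨k, hk⟩ := mem_iUnion.1 (hS hx)
      exact mem_iUnion.2 ⟨k, hXO k (hI k ⟨hk, hx⟩)⟩
    -- For J as long as the longest chosen word, a point of its cylinder lies in a chosen cylinder;
    -- disjointness of cylinders of equal level makes the chosen word a prefix of J.
    have htree := le_sum_of_forall_exists_prefix (T.sup fun k => (I k).length) w hw (T.image I)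
      (by
        intro J hJ
        obtain ⟨x, hx⟩ := h.nontrivial.nonempty
        obtain ⟨k, hk, hxk⟩ := mem_iUnion₂.1 (hT (h.mapsTo_wordMap J hx))
        refine ⟨I k, Finset.mem_image_of_mem _ hk, ?_⟩
        have hle : (I k).length ≤ J.length := by
          rw [hJ]
          exact Finset.le_sup (f := fun k => (I k).length) hk
        have hmem := hOX k ⟨hxk, h.mapsTo_wordMap J hx⟩
        have hpre : wordMap f J x ∈ wordMap f (J.take (I k).length) '' X := by
          refine ⟨wordMap f (J.drop (I k).length) x, h.mapsTo_wordMap _ hx, ?_⟩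
          rw [← wordMap_append, List.take_append_drop]
        rw [h.eq_of_mem_of_mem (by simp [hle]) hmem hpre]
        exact List.take_prefix _ _)
    calc w [] ≤ ∑ I ∈ T.image I, w I := htree
      _ ≤ ∑ k ∈ T, w (I k) := Finset.sum_image_le_of_nonneg fun _ _ => zero_le
      _ ≤ ∑' k, w (I k) := ENNReal.sum_le_tsum T
      _ ≤ ∑' k, (m (S k) + ε' k) := ENNReal.tsum_le_tsum hIw
      _ = ∑' k, m (S k) + ∑' k, ε' k := ENNReal.tsum_add
      _ ≤ _ := by gcongr
  have hle : OuterMeasure.ofFunction m hm0 ≤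
      OuterMeasure.mkMetric (ENNReal.ofReal (C ^ t) • fun x : ℝ≥0∞ => x ^ t) := by
    refine OuterMeasure.le_mkMetric _ _ 1 one_pos fun S _ => ?_
    exact (OuterMeasure.ofFunction_le S).trans (hm_diam S)
  have hCt : 0 < C ^ t := Real.rpow_pos_of_pos hC t
  rw [OuterMeasure.mkMetric_smul _ ENNReal.ofReal_ne_top
    (ENNReal.ofReal_pos.2 hCt).ne'] at hle
  intro h0
  have h1 := hcover.trans (hle X)
  rw [smul_apply, OuterMeasure.coe_mkMetric] at h1
  rw [Measure.hausdorffMeasure] at h0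
  simp only [h0, smul_eq_mul, mul_zero] at h1
  have h2 : 0 < w [] := ENNReal.ofReal_pos.2 (Real.rpow_pos_of_pos (h.pos []) t)
  exact absurd h1 (not_le.2 h2)

/-! ### Finiteness of the measure at the critical exponent -/

section Dimension

variable [Fintype ι] [MeasurableSpace E] [BorelSpace E] (h : IsQuasiSelfSimilar f X ℓ K r)
  (hdim : dimH X ≠ ∞)
include h hdim

/-- Both sides are continuous in the exponent, so a strict failure at the dimension persists at some
larger t, where the block system would have positive t-measure. -/
lemma sum_rpow_dimH_le {n : ℕ} (hn : 1 ≤ n) :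
    ∑ b : List.Vector ι n, ℓ b.1 ^ (dimH X).toReal ≤ (K ^ 3) ^ (dimH X).toReal := by
  by_contra! hlt
  set s := (dimH X).toReal with hs
  have hs0 : 0 ≤ s := ENNReal.toReal_nonneg
  have hc1 : Continuous fun t : ℝ => (K ^ 3) ^ t :=
    Real.continuous_const_rpow (pow_pos h.K_pos 3).ne'
  have hc2 : Continuous fun t : ℝ => ∑ b : List.Vector ι n, ℓ b.1 ^ t :=
    continuous_finsetSum _ fun b _ => Real.continuous_const_rpow (h.pos b.1).ne'
  have hev : ∀ᶠ t in 𝓝[>] s, (K ^ 3) ^ t < ∑ b : List.Vector ι n, ℓ b.1 ^ t :=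
    (hc1.continuousAt.eventually_lt hc2.continuousAt hlt).filter_mono nhdsWithin_le_nhds
  obtain ⟨t, htlt, hts⟩ := (hev.and self_mem_nhdsWithin).exists
  have hts' : s < t := hts
  have ht0 : 0 < t := hs0.trans_lt hts'
  have hne := (h.block hn).hausdorffMeasure_ne_zero ht0 (by
    refine htlt.le.trans_eq (Finset.sum_congr rfl fun b _ => ?_)
    rw [show flattenBlocks [b] = b.1 from List.append_nil _])
  have hle := le_dimH_of_hausdorffMeasure_ne_zero (s := X) (d := ⟨t, ht0.le⟩) hne
  have := ENNReal.toReal_mono hdim hle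
  exact absurd this (not_le.2 hts')

/-- At exponent 0 the level-one bound would say that there is at most one map. -/
lemma dimH_pos [Nontrivial ι] : 0 < (dimH X).toReal := by
  refine lt_of_le_of_ne ENNReal.toReal_nonneg fun h0 => ?_
  have := h.sum_rpow_dimH_le hdim le_rfl
  rw [← h0] at this
  simp only [Real.rpow_zero, Finset.sum_const, Finset.card_univ, card_vector, pow_one,
    nsmul_eq_mul, mul_one] at this
  have h1 : 1 < Fintype.card ι := Fintype.one_lt_card
  have h2 : (1 : ℝ) < Fintype.card ι := by exact_mod_cast h1
  linarith

lemma hausdorffMeasure_ne_top : μH[(dimH X).toReal] X ≠ ∞ := by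
  have hsum := fun (n : ℕ) (hn : 1 ≤ n) => h.sum_rpow_dimH_le hdim hn
  set s := (dimH X).toReal with hs
  have hs0 : 0 ≤ s := ENNReal.toReal_nonneg
  have hX : ediam X ≠ ∞ := h.isCompact.isBounded.ediam_ne_top
  have hKs : 0 ≤ K ^ s := Real.rpow_nonneg h.K_pos.le s
  refine ne_top_of_le_ne_top (b := ENNReal.ofReal (K ^ s * (K ^ 3) ^ s) * ediam X ^ s)
    (ENNReal.mul_ne_top ENNReal.ofReal_ne_top (ENNReal.rpow_ne_top_of_nonneg hs0 hX)) ?_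
  have hr : Tendsto (fun n : ℕ => ENNReal.ofReal (K * (K * r ^ n)) * ediam X) atTop (𝓝 0) := by
    have h1 : Tendsto (fun n : ℕ => K * (K * r ^ n)) atTop (𝓝 (K * (K * 0))) :=
      ((tendsto_pow_atTop_nhds_zero_of_lt_one h.ratio_pos.le h.ratio_lt_one).const_mul K).const_mul K
    have h2 := ENNReal.Tendsto.mul_const (ENNReal.tendsto_ofReal h1) (Or.inr hX)
    simpa using h2
  refine (Measure.hausdorffMeasure_le_liminf_sum (ι := fun n => List.Vector ι n) s X _ hr
    (fun n b => wordMap f b.1 '' X) (Eventually.of_forall fun n b => ?_)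
    (Eventually.of_forall fun n x hx => ?_)).trans ?_
  · refine (h.ediam_image_le b.1).trans ?_
    gcongr
    · exact h.K_pos.le
    · simpa [b.2] using h.ratio_le b.1
  · obtain ⟨I, hI, hxI⟩ := h.exists_wordMap_eq n hx
    exact mem_iUnion.2 ⟨⟨I, hI⟩, hxI⟩
  · refine Filter.liminf_le_of_frequently_le'
      (Eventually.frequently ((eventually_ge_atTop 1).mono fun n hn => ?_))
    calc ∑ b : List.Vector ι n, ediam (wordMap f b.1 '' X) ^ s
        ≤ ∑ b : List.Vector ι n, ENNReal.ofReal (K ^ s * ℓ b.1 ^ s) * ediam X ^ s := by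
          refine Finset.sum_le_sum fun b _ => ?_
          rw [← Real.mul_rpow h.K_pos.le (h.pos _).le,
            ← ENNReal.ofReal_rpow_of_nonneg (mul_pos h.K_pos (h.pos _)).le hs0,
            ← ENNReal.mul_rpow_of_nonneg _ _ hs0]
          exact ENNReal.rpow_le_rpow (h.ediam_image_le b.1) hs0
      _ = ENNReal.ofReal (K ^ s * ∑ b : List.Vector ι n, ℓ b.1 ^ s) * ediam X ^ s := by
          rw [← Finset.sum_mul, Finset.mul_sum, ENNReal.ofReal_sum_of_nonneg]
          exact fun b _ => mul_nonneg hKs (Real.rpow_nonneg (h.pos _).le s)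
      _ ≤ _ := by
          gcongr
          exact hsum n hn

end Dimension

end IsQuasiSelfSimilar


/-- `A` is, inside the union of the cylinders of level `n`, a union of such cylinders. -/
def IsSaturated {E ι : Type*} (f : ι → E → E) (X : Set E) (n : ℕ) (A : Set E) : Prop :=
  ∀ I : List ι, I.length = n → ∀ x ∈ wordMap f I '' X, ∀ y ∈ wordMap f I '' X, x ∈ A → y ∈ A

/-- The points whose coding has the word `J` right after its first `n` letters. -/
def wordAt {E ι : Type*} (f : ι → E → E) (X : Set E) (n : ℕ) (J : List ι) : Set E :=
  ⋃ b : List.Vector ι n, wordMap f (b.1 ++ J) '' X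

lemma IsSaturated.diff {E ι : Type*} {f : ι → E → E} {X : Set E} {n : ℕ} {A B : Set E}
    (hA : IsSaturated f X n A) (hB : IsSaturated f X n B) : IsSaturated f X n (A \ B) :=
  fun I hI x hx y hy hxA => ⟨hA I hI x hx y hy hxA.1, fun hyB => hxA.2 (hB I hI y hy x hx hyB)⟩

/-! ### Quasi-Bernoulli property and Borel–Cantelli argument -/

namespace IsQuasiSelfSimilar

variable {E ι : Type*} [MetricSpace E] {f : ι → E → E} {X : Set E} {ℓ : List ι → ℝ} {K r : ℝ}

section Measure

variable (h : IsQuasiSelfSimilar f X ℓ K r)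
include h

lemma isSaturated_mono {m n : ℕ} (hmn : m ≤ n) {A : Set E} (hA : IsSaturated f X m A) :
    IsSaturated f X n A := by
  intro I hI x hx y hy hxA
  have hsub := h.image_append_subset (I.take m) (I.drop m)
  rw [List.take_append_drop] at hsub
  exact hA (I.take m) (by simp [hI, hmn]) x (hsub hx) y (hsub hy) hxA

lemma isSaturated_wordAt (n : ℕ) (J : List ι) :
    IsSaturated f X (n + J.length) (wordAt f X n J) := by
  intro I hI x hx y hy hxA
  obtain ⟨b, hb⟩ := mem_iUnion.1 hxA
  have : I = b.1 ++ J := h.eq_of_mem_of_mem (by simp [hI, b.2]) hx hb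
  exact mem_iUnion.2 ⟨b, this ▸ hy⟩

variable [MeasurableSpace E] [BorelSpace E]

lemma hausdorffMeasure_image_le {s : ℝ} (hs : 0 ≤ s) (I : List ι) {A : Set E} (hA : A ⊆ X) :
    μH[s] (wordMap f I '' A) ≤ ENNReal.ofReal ((K * ℓ I) ^ s) * μH[s] A := by
  rw [← ENNReal.ofReal_rpow_of_nonneg (mul_pos h.K_pos (h.pos I)).le hs]
  exact ((h.lipschitzOnWith I).mono hA).hausdorffMeasure_image_le hs

lemma hausdorffMeasure_le_image {s : ℝ} (hs : 0 ≤ s) (I : List ι) {A : Set E} (hA : A ⊆ X) :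
    μH[s] A ≤ ENNReal.ofReal ((K / ℓ I) ^ s) * μH[s] (wordMap f I '' A) := by
  obtain ⟨x₀, _⟩ := h.nontrivial.nonempty
  have : Nonempty E := ⟨x₀⟩
  have hKl := (div_pos h.K_pos (h.pos I)).le
  let g := Function.invFunOn (wordMap f I) X
  have hg : ∀ x ∈ X, g (wordMap f I x) = x := fun x hx => (h.injOn I).leftInvOn_invFunOn hx
  have hlip : LipschitzOnWith (Real.toNNReal (K / ℓ I)) g (wordMap f I '' A) := by
    refine LipschitzOnWith.of_dist_le_mul ?_
    rintro _ ⟨x, hx, rfl⟩ _ ⟨y, hy, rfl⟩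
    rw [Real.coe_toNNReal _ hKl, hg x (hA hx), hg y (hA hy), div_mul_eq_mul_div,
      le_div_iff₀ (h.pos I), mul_comm]
    exact h.lower I x (hA hx) y (hA hy)
  have himg : g '' (wordMap f I '' A) = A := by
    rw [image_image]
    exact (image_congr fun x hx => hg x (hA hx)).trans (image_id' A)
  have := hlip.hausdorffMeasure_image_le hs
  rw [himg] at this
  rwa [← ENNReal.ofReal_rpow_of_nonneg hKl hs]

/-- Compare the cylinder of I with X, X with the cylinder of J, and the latter with its image under
`wordMap f I`. The ratio `ℓ I` cancels and three factors `K` remain. -/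
lemma measureReal_append {s : ℝ} (hs : 0 ≤ s) (hfin : μH[s] X ≠ ∞) (I J : List ι) :
    (ℓ J / K ^ 3) ^ s * (μH[s]).real (wordMap f I '' X) ≤
      (μH[s]).real (wordMap f (I ++ J) '' X) := by
  have hpos := fun a : ℝ => fun ha : 0 < a => Real.rpow_pos_of_pos ha s
  have hI := h.pos I
  have hJ := h.pos J
  have hK := h.K_pos
  have h1 := h.hausdorffMeasure_image_le hs I (subset_refl X)
  have h2 := h.hausdorffMeasure_le_image hs J (subset_refl X)
  have h3 := h.hausdorffMeasure_le_image hs I (h.image_subset J)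
  rw [← wordMap_append_image] at h3
  have hne : ∀ L, μH[s] (wordMap f L '' X) ≠ ∞ := fun L =>
    ne_top_of_le_ne_top hfin (measure_mono (h.image_subset L))
  have key := h1.trans (mul_le_mul_right (h2.trans (mul_le_mul_right h3 _)) _)
  have key' := ENNReal.toReal_mono (ENNReal.mul_ne_top ENNReal.ofReal_ne_top
    (ENNReal.mul_ne_top ENNReal.ofReal_ne_top (ENNReal.mul_ne_top ENNReal.ofReal_ne_top
      (hne (I ++ J))))) key
  simp only [ENNReal.toReal_mul] at key'
  rw [ENNReal.toReal_ofReal (hpos _ (by positivity)).le,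
    ENNReal.toReal_ofReal (hpos _ (by positivity)).le,
    ENNReal.toReal_ofReal (hpos _ (by positivity)).le, ← mul_assoc, ← mul_assoc,
    ← Real.mul_rpow (by positivity) (by positivity),
    ← Real.mul_rpow (by positivity) (by positivity)] at key'
  have hc : K * ℓ I * (K / ℓ J) * (K / ℓ I) = K ^ 3 / ℓ J := by field_simp
  rw [hc] at key'
  calc _ ≤ (ℓ J / K ^ 3) ^ s * ((K ^ 3 / ℓ J) ^ s * (μH[s]).real (wordMap f (I ++ J) '' X)) :=
        mul_le_mul_of_nonneg_left key' (hpos _ (by positivity)).le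
    _ = _ := by
        rw [← mul_assoc, ← Real.mul_rpow (by positivity) (by positivity)]
        have : ℓ J / K ^ 3 * (K ^ 3 / ℓ J) = 1 := by field_simp
        rw [this, Real.one_rpow, one_mul]

variable [Finite ι]

lemma measurableSet_wordAt (n : ℕ) (J : List ι) : MeasurableSet (wordAt f X n J) := by
  have : Fintype ι := Fintype.ofFinite ι
  exact MeasurableSet.iUnion fun b => (h.isCompact_image _).measurableSet

/-- A saturated A is a disjoint union of whole cylinders of level n, and each of them loses at least
the proportion given by `measureReal_append`. -/
lemma measureReal_diff_wordAt_le {s : ℝ} (hs : 0 ≤ s) (hfin : μH[s] X ≠ ∞) {n : ℕ} {A : Set E}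
    (hAX : A ⊆ X) (hAm : MeasurableSet A) (hA : IsSaturated f X n A) (J : List ι) :
    (μH[s]).real (A \ wordAt f X n J) ≤ (1 - (ℓ J / K ^ 3) ^ s) * (μH[s]).real A := by
  have : Fintype ι := Fintype.ofFinite ι
  have hne : ∀ B ⊆ X, μH[s] B ≠ ∞ := fun B hB => ne_top_of_le_ne_top hfin (measure_mono hB)
  have hdecomp : ∀ B ⊆ X, MeasurableSet B → (μH[s]).real B =
      ∑ b : List.Vector ι n, (μH[s]).real (B ∩ wordMap f b.1 '' X) := by
    intro B hB hBm
    have hU : B = ⋃ b ∈ (Finset.univ : Finset (List.Vector ι n)), B ∩ wordMap f b.1 '' X := by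
      refine subset_antisymm (fun x hx => ?_) (iUnion₂_subset fun b _ => inter_subset_left)
      obtain ⟨I, hI, hxI⟩ := h.exists_wordMap_eq n (hB hx)
      exact mem_iUnion₂.2 ⟨⟨I, hI⟩, Finset.mem_univ _, hx, hxI⟩
    conv_lhs => rw [hU]
    refine measureReal_biUnion_finset (fun a _ b _ hab => ?_)
      (fun b _ => hBm.inter (h.isCompact_image b.1).measurableSet)
      (fun b _ => hne _ (inter_subset_left.trans hB))
    refine disjoint_left.2 fun x hxa hxb => hab (Subtype.ext ?_)
    exact h.eq_of_mem_of_mem (a.2.trans b.2.symm) hxa.2 hxb.2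
  have hW := h.measurableSet_wordAt n J
  have hinter : (ℓ J / K ^ 3) ^ s * (μH[s]).real A ≤ (μH[s]).real (A ∩ wordAt f X n J) := by
    rw [hdecomp A hAX hAm, hdecomp (A ∩ wordAt f X n J) (inter_subset_left.trans hAX)
      (hAm.inter hW), Finset.mul_sum]
    refine Finset.sum_le_sum fun b _ => ?_
    rcases (A ∩ wordMap f b.1 '' X).eq_empty_or_nonempty with hemp | ⟨x, hxA, hxb⟩
    · rw [hemp, measureReal_empty, mul_zero]
      exact measureReal_nonneg
    · have hsub : wordMap f b.1 '' X ⊆ A := fun y hy => hA b.1 b.2 x hxb y hy hxA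
      rw [inter_eq_right.2 hsub]
      refine (h.measureReal_append hs hfin b.1 J).trans (measureReal_mono ?_ ?_)
      · intro y hy
        have hyb := h.image_append_subset b.1 J hy
        exact ⟨⟨hsub hyb, mem_iUnion.2 ⟨b, hy⟩⟩, hyb⟩
      · exact hne _ (inter_subset_right.trans (h.image_subset b.1))
  have := measureReal_sdiff_add_inter (μ := μH[s]) (s := A) hW (hne A hAX)
  linarith

lemma measure_diff_iUnion_wordAt {s : ℝ} (hs : 0 ≤ s) (hfin : μH[s] X ≠ ∞) (n : ℕ → ℕ)
    (J : ℕ → List ι) (hn : ∀ k, n k + (J k).length ≤ n (k + 1))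
    (hJ : ¬ Summable fun k => ℓ (J k) ^ s) : μH[s] (X \ ⋃ k, wordAt f X (n k) (J k)) = 0 := by
  -- The points that miss the first j windows. Those windows end by level `n j`, so this set is
  -- saturated there and the next removal acts almost independently; the measure decays like the
  -- product of the factors `1 - c k`.
  let A : ℕ → Set E := fun j => Nat.rec X (fun k A => A \ wordAt f X (n k) (J k)) j
  have hAsucc : ∀ k, A (k + 1) = A k \ wordAt f X (n k) (J k) := fun k => rfl
  have hA : ∀ k, A k ⊆ X ∧ MeasurableSet (A k) ∧ IsSaturated f X (n k) (A k) := by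
    intro k
    induction k with
    | zero => exact ⟨subset_refl X, h.isCompact.measurableSet,
        fun I _ x _ y hy _ => h.image_subset I hy⟩
    | succ k ih =>
      rw [hAsucc]
      refine ⟨sdiff_subset.trans ih.1, ih.2.1.diff (h.measurableSet_wordAt _ _), ?_⟩
      refine IsSaturated.diff (h.isSaturated_mono ?_ ih.2.2)
        (h.isSaturated_mono (hn k) (h.isSaturated_wordAt _ _))
      exact (Nat.le_add_right _ _).trans (hn k)
  let c : ℕ → ℝ := fun k => (ℓ (J k) / K ^ 3) ^ s
  have hc : ∀ k, 0 ≤ c k := fun k =>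
    Real.rpow_nonneg (div_pos (h.pos _) (pow_pos h.K_pos 3)).le s
  have hbound : ∀ k, (μH[s]).real (A k) ≤
      Real.exp (-∑ j ∈ Finset.range k, c j) * (μH[s]).real X := by
    intro k
    induction k with
    | zero => simp [A]
    | succ k ih =>
      calc _ ≤ (1 - c k) * (μH[s]).real (A k) :=
            h.measureReal_diff_wordAt_le hs hfin (hA k).1 (hA k).2.1 (hA k).2.2 (J k)
        _ ≤ Real.exp (-c k) * (μH[s]).real (A k) := by
            gcongr
            exact Real.one_sub_le_exp_neg _
        _ ≤ Real.exp (-c k) * (Real.exp (-∑ j ∈ Finset.range k, c j) * (μH[s]).real X) := by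
            gcongr
        _ = _ := by
            rw [← mul_assoc, ← Real.exp_add, Finset.sum_range_succ]
            congr 2
            ring
  have hsum : ¬ Summable c := by
    intro hS
    apply hJ
    have : (fun k => ℓ (J k) ^ s) = fun k => (K ^ 3) ^ s * c k := by
      ext k
      simp only [c]
      rw [Real.div_rpow (h.pos _).le (pow_pos h.K_pos 3).le, mul_div_cancel₀]
      exact (Real.rpow_pos_of_pos (pow_pos h.K_pos 3) s).ne'
    rw [this]
    exact hS.mul_left _
  have hlim : Tendsto (fun k => Real.exp (-∑ j ∈ Finset.range k, c j) * (μH[s]).real X) atTop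
      (𝓝 0) := by
    have h1 := (not_summable_iff_tendsto_nat_atTop_of_nonneg hc).1 hsum
    have h2 := (Real.tendsto_exp_neg_atTop_nhds_zero.comp h1).mul_const ((μH[s]).real X)
    simpa using h2
  have hfin' : μH[s] (X \ ⋃ k, wordAt f X (n k) (J k)) ≠ ∞ :=
    ne_top_of_le_ne_top hfin (measure_mono sdiff_subset)
  have hsubA : ∀ k, X \ ⋃ k, wordAt f X (n k) (J k) ⊆ A k := by
    intro k
    induction k with
    | zero => exact sdiff_subset
    | succ k ih =>
      exact fun x hx => ⟨ih hx, fun hx' => hx.2 (mem_iUnion.2 ⟨k, hx'⟩)⟩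
  rw [← measureReal_eq_zero_iff hfin']
  refine le_antisymm (ge_of_tendsto' hlim fun k => ?_) measureReal_nonneg
  exact (measureReal_mono (hsubA k) (ne_top_of_le_ne_top hfin (measure_mono (hA k).1))).trans
    (hbound k)

lemma ae_frequently_mem_wordAt {s : ℝ} (hs : 0 ≤ s) (hfin : μH[s] X ≠ ∞) (n : ℕ → ℕ)
    (J : ℕ → List ι) (hn : ∀ k, n k + (J k).length ≤ n (k + 1))
    (hJ : ¬ Summable fun k => ℓ (J k) ^ s) :
    ∀ᵐ x ∂(μH[s]).restrict X, ∃ᶠ k in atTop, x ∈ wordAt f X (n k) (J k) := by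
  have H : ∀ k₀ : ℕ, ∀ᵐ x ∂(μH[s]).restrict X, ∃ k, x ∈ wordAt f X (n (k + k₀)) (J (k + k₀)) := by
    intro k₀
    rw [ae_restrict_iff' h.isCompact.measurableSet]
    refine measure_mono_null ?_ (h.measure_diff_iUnion_wordAt hs hfin (fun k => n (k + k₀))
      (fun k => J (k + k₀)) (fun k => ?_) ?_)
    · intro x hx
      simp only [mem_compl_iff, mem_ofPred_eq, Classical.not_imp, not_exists] at hx
      exact ⟨hx.1, fun hx' => by
        obtain ⟨k, hk⟩ := mem_iUnion.1 hx'
        exact hx.2 k hk⟩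
    · have := hn (k + k₀)
      rwa [show k + k₀ + 1 = k + 1 + k₀ by ring] at this
    · rwa [summable_nat_add_iff (f := fun k => ℓ (J k) ^ s) k₀]
  filter_upwards [ae_all_iff.2 H] with x hx
  refine frequently_atTop.2 fun k₀ => ?_
  obtain ⟨k, hk⟩ := hx k₀
  exact ⟨k + k₀, Nat.le_add_left _ _, hk⟩

end Measure

/-! ### Cylinders shrinking to the target point -/

section Targets

variable (h : IsQuasiSelfSimilar f X ℓ K r)
include h

/-- Both points are images under `wordMap f I` of points of the small cylinder of J. One factor `K`
comes from the upper bound, the other from comparing `ℓ I` with the diameter. -/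
lemma dist_wordMap_le_of_mem {z : E} {I J : List ι} {τ : ℝ} (hz : z ∈ wordMap f J '' X)
    (hτ : 0 ≤ τ) (hJ : diam (wordMap f J '' X) ≤ τ * diam X) {x : E}
    (hx : x ∈ wordMap f (I ++ J) '' X) :
    dist x (wordMap f I z) ≤ diam (wordMap f I '' X) * (K ^ 2 * τ) := by
  rw [wordMap_append_image] at hx
  obtain ⟨u, hu, rfl⟩ := hx
  have hK := h.K_pos
  have hI := h.pos I
  calc dist (wordMap f I u) (wordMap f I z)
      ≤ K * ℓ I * dist u z := h.upper I u (h.image_subset J hu) z (h.image_subset J hz)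
    _ ≤ K * ℓ I * (τ * diam X) := by
        gcongr
        exact (dist_le_diam_of_mem (h.isCompact_image J).isBounded hu hz).trans hJ
    _ = K * τ * (ℓ I * diam X) := by ring
    _ ≤ K * τ * (K * diam (wordMap f I '' X)) :=
        mul_le_mul_of_nonneg_left (h.le_diam_image I) (by positivity)
    _ = _ := by ring

variable [Finite ι]

/-- Around each point of `X` there is a cylinder of any prescribed relative diameter, with control
of its level. -/
lemma exists_target {z : E} (hz : z ∈ X) : ∃ c : ℝ, 0 < c ∧ ∀ τ : ℝ, 0 < τ → τ ≤ 1 →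
    ∀ L : ℕ, r ^ L ≤ τ → ∃ J : List ι, J.length ≤ L ∧ z ∈ wordMap f J '' X ∧
      diam (wordMap f J '' X) ≤ τ * diam X ∧ c * τ ≤ ℓ J := by
  have hz' := hz
  rw [h.eq_iUnion] at hz'
  obtain ⟨i₀, _⟩ := mem_iUnion.1 hz'
  have : Nonempty ι := ⟨i₀⟩
  obtain ⟨i₁, hi₁⟩ := Finite.exists_min fun i => ℓ [i]
  have hK := h.K_pos
  have hK1 := h.one_le
  have hl := h.pos [i₁]
  -- The first term serves the empty word. In the second, `K ^ 3` comes from `mul_le` and one more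
  -- `K` from the diameter of the parent cylinder.
  refine ⟨min (1 / K) (ℓ [i₁] / K ^ 4), by positivity, fun τ hτ hτ1 L hL => ?_⟩
  have hex : ∃ m, ∃ J : List ι, J.length = m ∧ z ∈ wordMap f J '' X ∧
      diam (wordMap f J '' X) ≤ τ * diam X := by
    obtain ⟨J, hJ, hzJ⟩ := h.exists_wordMap_eq L hz
    refine ⟨L, J, hJ, hzJ, (h.diam_image_le_pow J).trans ?_⟩
    rw [hJ]
    exact mul_le_mul_of_nonneg_right hL diam_nonneg
  classical
  -- A shortest admissible J: its parent is still too large, which bounds `ℓ J` below.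
  obtain ⟨J, hJ, hzJ, hJd⟩ := Nat.find_spec hex
  have hmin := fun k => Nat.find_min hex (m := k)
  have hmL : Nat.find hex ≤ L := by
    refine Nat.find_min' hex ?_
    obtain ⟨J, hJ, hzJ⟩ := h.exists_wordMap_eq L hz
    refine ⟨J, hJ, hzJ, (h.diam_image_le_pow J).trans ?_⟩
    rw [hJ]
    exact mul_le_mul_of_nonneg_right hL diam_nonneg
  refine ⟨J, hJ.le.trans hmL, hzJ, hJd, ?_⟩
  rcases List.eq_nil_or_concat J with rfl | ⟨J', i, rfl⟩
  · have h1 := h.one_le_mul_ratio_nil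
    calc min (1 / K) (ℓ [i₁] / K ^ 4) * τ ≤ 1 / K * 1 :=
          mul_le_mul (min_le_left _ _) hτ1 hτ.le (by positivity)
      _ ≤ ℓ [] := by
          rw [mul_one, div_le_iff₀ hK, mul_comm]
          exact h1
  · rw [List.concat_eq_append] at hJ hzJ ⊢
    have hlt : τ * diam X < diam (wordMap f J' '' X) := by
      by_contra! hle
      refine hmin J'.length ?_ ⟨J', rfl, h.image_append_subset J' [i] hzJ, hle⟩
      rw [← hJ]
      simp
    have h1 := h.diam_image_le J'
    have h2 : τ < K * ℓ J' := lt_of_mul_lt_mul_right (hlt.trans_le h1) diam_nonneg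
    have h3 := h.mul_le J' [i]
    have h4 := h.pos J'
    calc min (1 / K) (ℓ [i₁] / K ^ 4) * τ ≤ ℓ [i₁] / K ^ 4 * (K * ℓ J') :=
          mul_le_mul (min_le_right _ _) h2.le hτ.le (by positivity)
      _ = ℓ J' * ℓ [i₁] / K ^ 3 := by field_simp
      _ ≤ ℓ J' * ℓ [i] / K ^ 3 := by
          gcongr
          exact hi₁ i
      _ ≤ ℓ (J' ++ [i]) := by
          rw [div_le_iff₀ (by positivity)]
          linarith

end Targets

end IsQuasiSelfSimilar

/-! ### Divergence of the series and length of the windows -/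

/-- Cauchy condensation at powers of 2 reduces this to the harmonic series. -/
lemma not_summable_one_div_mul_log :
    ¬ Summable fun k : ℕ => 1 / (((k + 1) * (Nat.log 2 (k + 1) + 1) : ℕ) : ℝ) := by
  let g : ℕ → ℝ := fun k => 1 / ((k * (Nat.log 2 k + 1) : ℕ) : ℝ)
  have hg : ¬ Summable g := by
    rw [← summable_condensed_iff_of_nonneg]
    · have : (fun k : ℕ => (2 : ℝ) ^ k * g (2 ^ k)) = fun k : ℕ => 1 / ((k + 1 : ℕ) : ℝ) := by
        ext k
        simp only [g, Nat.log_pow one_lt_two]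
        push_cast
        field_simp
      rw [this, summable_nat_add_iff (f := fun k : ℕ => 1 / (k : ℝ)) 1]
      exact Real.not_summable_one_div_natCast
    · intro n
      positivity
    · intro m n hm hmn
      have h1 := Nat.log_mono_right (b := 2) hmn
      have h2 : m * (Nat.log 2 m + 1) ≤ n * (Nat.log 2 n + 1) := by gcongr
      refine one_div_le_one_div_of_le ?_ (by exact_mod_cast h2)
      exact_mod_cast Nat.mul_pos hm (Nat.succ_pos _)
  intro hS
  exact hg ((summable_nat_add_iff (f := g) 1).1 hS)

/-- Room for the windows: one factor `M` makes `r ^ (M p)` small against a negative power of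
`M 4 ^ p`. -/
lemma exists_pow_le_rpow {r s D : ℝ} (hr0 : 0 < r) (hr1 : r < 1) (hs : 0 < s) (hD0 : 0 < D)
    (hD1 : D ≤ 1) : ∃ M : ℕ, 1 ≤ M ∧ ∀ p : ℕ, 1 ≤ p →
      r ^ (M * p) ≤ ((M * 4 ^ p : ℕ) : ℝ) ^ (-(1 / s)) * D := by
  obtain ⟨q, hq⟩ := exists_nat_ge (1 / s)
  have hlim := tendsto_pow_const_mul_const_pow_of_abs_lt_one q
    (r := r) (by rwa [abs_of_pos hr0])
  have h4 : (0 : ℝ) < 4 ^ (-(1 / s)) := Real.rpow_pos_of_pos (by norm_num) _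
  -- `M` occurs on both sides of the goal; the exponential `r ^ M` beats the power of `M`, which
  -- settles p = 1 with `4 ^ (-(1 / s))` to spare. Taking p-th powers gives the rest, since the
  -- remaining factor is at most 1.
  obtain ⟨M, hM, hM1⟩ :=
    ((hlim.eventually_le_const (mul_pos h4 hD0)).and (eventually_ge_atTop 1)).exists
  refine ⟨M, hM1, fun p hp => ?_⟩
  have hM0 : (1 : ℝ) ≤ M := by exact_mod_cast hM1
  have hMs : (0 : ℝ) < (M : ℝ) ^ (-(1 / s)) := Real.rpow_pos_of_pos (by linarith) _
  have hMs1 : (M : ℝ) ^ (-(1 / s)) ≤ 1 := Real.rpow_le_one_of_one_le_of_nonpos hM0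
    (by have := one_div_pos.2 hs; linarith)
  have hbase : r ^ M ≤ (M : ℝ) ^ (-(1 / s)) * D * 4 ^ (-(1 / s)) := by
    have h1 : (M : ℝ) ^ (1 / s) ≤ (M : ℝ) ^ q := by
      rw [← Real.rpow_natCast]
      exact Real.rpow_le_rpow_of_exponent_le hM0 hq
    have h2 : (M : ℝ) ^ (1 / s) * r ^ M ≤ 4 ^ (-(1 / s)) * D := by
      refine le_trans ?_ hM
      gcongr
    calc r ^ M = (M : ℝ) ^ (-(1 / s)) * ((M : ℝ) ^ (1 / s) * r ^ M) := by
          rw [← mul_assoc, ← Real.rpow_add (by linarith)]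
          simp
      _ ≤ (M : ℝ) ^ (-(1 / s)) * (4 ^ (-(1 / s)) * D) := by gcongr
      _ = _ := by ring
  calc r ^ (M * p) = (r ^ M) ^ p := pow_mul _ _ _
    _ ≤ ((M : ℝ) ^ (-(1 / s)) * D * 4 ^ (-(1 / s))) ^ p := by gcongr
    _ = ((M : ℝ) ^ (-(1 / s)) * D) ^ p * (4 ^ (-(1 / s))) ^ p := mul_pow _ _ _
    _ ≤ ((M : ℝ) ^ (-(1 / s)) * D) * (4 ^ (-(1 / s))) ^ p := by
        gcongr
        exact pow_le_of_le_one (by positivity) (mul_le_one₀ hMs1 hD0.le hD1) (by omega)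
    _ = _ := by
        push_cast
        rw [Real.mul_rpow (by positivity) (by positivity), ← Real.rpow_natCast,
          ← Real.rpow_natCast, ← Real.rpow_mul (by norm_num), ← Real.rpow_mul (by norm_num),
          mul_comm (p : ℝ)]
        ring

/-! ### Full measure of the limsup set -/

namespace IsQuasiSelfSimilar

variable {E ι : Type*} [MetricSpace E] {f : ι → E → E} {X : Set E} {ℓ : List ι → ℝ} {K r : ℝ}

/-- A limsup set with targets of relative radius at least of order `n ^ (-1 / s)` has full
`s`-dimensional measure, if that measure is finite. -/
theorem ae_mem_W [Finite ι] [MeasurableSpace E] [BorelSpace E]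
    (h : IsQuasiSelfSimilar f X ℓ K r) {s : ℝ} (hs : 0 < s) (hfin : μH[s] X ≠ ∞) {z : E}
    (hz : z ∈ X) (θ : ℕ → ℝ≥0) {C : ℝ}
    (hθ : ∀ n : ℕ, 1 ≤ n → (n : ℝ) ^ (-(1 / s)) ≤ C * θ n) :
    ∀ᵐ x ∂(μH[s]).restrict X, x ∈ W f X θ z := by
  have hK := h.K_pos
  set C' := max C 1 with hC'
  have hC'1 : 1 ≤ C' := le_max_right _ _
  have hC'0 : 0 < C' := by linarith
  -- Absorbs the loss `K ^ 2` of `dist_wordMap_le_of_mem` and the constant in the bound for θ. The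
  -- maximum with 1 in `C'` keeps `D` in (0, 1].
  set D : ℝ := 1 / (C' * K ^ 2) with hD
  have hD0 : 0 < D := by positivity
  have hD1 : D ≤ 1 := by
    rw [hD, div_le_one (by positivity)]
    nlinarith [one_le_pow₀ (n := 2) h.one_le]
  obtain ⟨M, hM1, hM⟩ := exists_pow_le_rpow h.ratio_pos h.ratio_lt_one hs hD0 hD1
  obtain ⟨c, hc, htarget⟩ := h.exists_target hz
  -- The window at `n k` has length at most `M * p k`, and consecutive times differ by at least that
  -- much. Logarithmic windows suffice for targets of polynomial size and keep the sum of `1 / n k`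
  -- divergent.
  let p : ℕ → ℕ := fun k => Nat.log 2 (k + 1) + 1
  let n : ℕ → ℕ := fun k => M * ((k + 1) * p k)
  have hp1 : ∀ k, 1 ≤ p k := fun k => Nat.succ_le_succ (Nat.zero_le _)
  have hn1 : ∀ k, 1 ≤ n k := fun k =>
    Nat.mul_pos hM1 (Nat.mul_pos (Nat.succ_pos k) (hp1 k))
  have hn4 : ∀ k, n k ≤ M * 4 ^ p k := fun k => by
    have h1 : k + 1 < 2 ^ p k := Nat.lt_pow_succ_log_self one_lt_two _
    have h2 : p k < 2 ^ p k := Nat.lt_two_pow_self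
    have h3 : (4 : ℕ) ^ p k = 2 ^ p k * 2 ^ p k := by rw [← mul_pow]; rfl
    rw [h3]
    exact Nat.mul_le_mul_left _ (Nat.mul_le_mul h1.le h2.le)
  let τ : ℕ → ℝ := fun k => (n k : ℝ) ^ (-(1 / s)) * D
  have hn1' : ∀ k, (1 : ℝ) ≤ n k := fun k => by exact_mod_cast hn1 k
  have hs' : -(1 / s) ≤ 0 := by
    have := one_div_pos.2 hs
    linarith
  have hτ0 : ∀ k, 0 < τ k := fun k =>
    mul_pos (Real.rpow_pos_of_pos (by linarith [hn1' k]) _) hD0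
  have hτ1 : ∀ k, τ k ≤ 1 := fun k =>
    mul_le_one₀ (Real.rpow_le_one_of_one_le_of_nonpos (hn1' k) hs') hD0.le hD1
  have hτL : ∀ k, r ^ (M * p k) ≤ τ k := fun k => by
    refine (hM (p k) (hp1 k)).trans ?_
    refine mul_le_mul_of_nonneg_right ?_ hD0.le
    exact Real.rpow_le_rpow_of_nonpos (by linarith [hn1' k]) (by exact_mod_cast hn4 k) hs'
  choose J hJlen hzJ hJdiam hJl using fun k => htarget (τ k) (hτ0 k) (hτ1 k) (M * p k) (hτL k)
  have hwin : ∀ k, n k + (J k).length ≤ n (k + 1) := fun k => by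
    have h1 : p k ≤ p (k + 1) :=
      Nat.succ_le_succ (Nat.log_mono_right (by omega))
    calc n k + (J k).length ≤ M * ((k + 1) * p k) + M * p k := Nat.add_le_add_left (hJlen k) _
      _ = M * ((k + 1 + 1) * p k) := by ring
      _ ≤ M * ((k + 1 + 1) * p (k + 1)) := by gcongr
  have hdiv : ¬ Summable fun k => ℓ (J k) ^ s := by
    intro hS
    have hb : ∀ k, (c * D) ^ s / M * (1 / (((k + 1) * (Nat.log 2 (k + 1) + 1) : ℕ) : ℝ)) ≤
        ℓ (J k) ^ s := fun k => by
      calc _ = (c * D) ^ s * (n k : ℝ)⁻¹ := by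
            simp only [n, p]
            push_cast
            field_simp
        _ = (c * τ k) ^ s := by
            have : c * τ k = c * D * (n k : ℝ) ^ (-(1 / s)) := by
              simp only [τ]
              ring
            rw [this, Real.mul_rpow (mul_pos hc hD0).le
              (Real.rpow_nonneg (by linarith [hn1' k]) _),
              ← Real.rpow_mul (by linarith [hn1' k]),
              show -(1 / s) * s = -1 by field_simp, Real.rpow_neg_one]
        _ ≤ _ := Real.rpow_le_rpow (mul_pos hc (hτ0 k)).le (hJl k) hs.le
    have hS' := Summable.of_nonneg_of_le (fun k => by positivity) hb hS
    rw [summable_mul_left_iff] at hS'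
    · exact not_summable_one_div_mul_log hS'
    · have : (0 : ℝ) < M := by exact_mod_cast hM1
      positivity
  -- Hits at different k thus give words of different lengths, hence infinitely many words.
  have hn_inj : StrictMono n := strictMono_nat_of_lt_succ fun k => by
    have h1 : p k ≤ p (k + 1) := Nat.succ_le_succ (Nat.log_mono_right (by omega))
    refine Nat.mul_lt_mul_of_pos_left ?_ hM1
    calc (k + 1) * p k < (k + 1 + 1) * p k := Nat.mul_lt_mul_of_pos_right (by omega) (hp1 k)
      _ ≤ (k + 1 + 1) * p (k + 1) := by gcongr
  have hX : ∀ᵐ x ∂(μH[s]).restrict X, x ∈ X := ae_restrict_mem h.isCompact.measurableSet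
  filter_upwards [h.ae_frequently_mem_wordAt hs.le hfin n J hwin hdiv, hX] with x hx hxX
  refine ⟨hxX, ?_⟩
  have hinf : (n '' {k | x ∈ wordAt f X (n k) (J k)}).Infinite :=
    (Nat.frequently_atTop_iff_infinite.1 hx).image hn_inj.injective.injOn
  refine Infinite.of_image List.length (hinf.mono ?_)
  rintro _ ⟨k, hk, rfl⟩
  obtain ⟨b, hb⟩ := mem_iUnion.1 hk
  refine ⟨b.1, ⟨?_, ?_⟩, b.2⟩
  · intro hnil
    have h0 : b.1.length = n k := b.2
    rw [hnil, List.length_nil] at h0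
    have := hn1 k
    omega
  · rw [mem_closedBall]
    refine (h.dist_wordMap_le_of_mem (hzJ k) (hτ0 k).le (hJdiam k) hb).trans ?_
    refine mul_le_mul_of_nonneg_left ?_ diam_nonneg
    rw [b.2]
    have h1 : (n k : ℝ) ^ (-(1 / s)) ≤ C' * θ (n k) :=
      (hθ (n k) (hn1 k)).trans
        (mul_le_mul_of_nonneg_right (le_max_left _ _) (NNReal.coe_nonneg _))
    calc K ^ 2 * τ k = (n k : ℝ) ^ (-(1 / s)) / C' := by
          simp only [τ, hD]
          field_simp
      _ ≤ θ (n k) := by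
          rw [div_le_iff₀ hC'0, mul_comm]
          exact h1

end IsQuasiSelfSimilar


/-! ### From summable to bounded distortion -/

section Distortion

variable {E ι : Type*} [MetricSpace E]

/-- The product of the factors `N i` along the orbit of `x` under the word. -/
def wordProd (f : ι → E → E) (N : ι → E → ℝ) : List ι → E → ℝ
  | [], _ => 1
  | i :: I, x => N i (wordMap f I x) * wordProd f N I x

/-- Summable distortion of the single maps gives bounded distortion of all compositions. -/
lemma isQuasiSelfSimilar_of_distortion {f : ι → E → E} {X : Set E} (hXn : X.Nontrivial)
    (hXc : IsCompact X) (hXeq : X = ⋃ i, f i '' X) (hsep : StrongSeparation f X)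
    {r : ℝ} (hr0 : 0 < r) (hr1 : r < 1)
    (hcontr : ∀ i, ∀ x ∈ X, ∀ y ∈ X, dist (f i x) (f i y) ≤ r * dist x y)
    {N : ι → E → ℝ} (hN : ∀ i, ∀ x ∈ X, 0 < N i x) {B q : ℝ} (hB : 0 ≤ B) (hq0 : 0 ≤ q)
    (hq1 : q < 1)
    (hdist : ∀ i, ∀ k : ℕ, ∀ x ∈ X, ∀ y ∈ X, dist x y ≤ r ^ k * diam X →
      N i x * Real.exp (-(B * q ^ k)) * dist x y ≤ dist (f i x) (f i y) ∧
      dist (f i x) (f i y) ≤ N i x * Real.exp (B * q ^ k) * dist x y) :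
    ∃ ℓ K, IsQuasiSelfSimilar f X ℓ K r := by
  have hmaps : ∀ I, MapsTo (wordMap f I) X X := by
    intro I
    induction I with
    | nil => exact mapsTo_id X
    | cons i I ih =>
      intro x hx
      rw [hXeq]
      exact mem_iUnion.2 ⟨i, mem_image_of_mem _ (ih hx)⟩
  have hG : ∀ I, ∀ x ∈ X, 0 < wordProd f N I x := by
    intro I x hx
    induction I with
    | nil => exact one_pos
    | cons i I ih => exact mul_pos (hN i _ (hmaps I hx)) ih
  have hsmall : ∀ I : List ι, ∀ x ∈ X, ∀ y ∈ X,
      dist (wordMap f I x) (wordMap f I y) ≤ r ^ I.length * diam X := by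
    intro I x hx y hy
    induction I with
    | nil => simpa [wordMap] using dist_le_diam_of_mem hXc.isBounded hx hy
    | cons i I ih =>
      calc _ ≤ r * dist (wordMap f I x) (wordMap f I y) := hcontr i _ (hmaps I hx) _ (hmaps I hy)
        _ ≤ r * (r ^ I.length * diam X) := by gcongr
        _ = _ := by rw [List.length_cons, pow_succ]; ring
  have hword : ∀ I : List ι, ∀ x ∈ X, ∀ y ∈ X,
      wordProd f N I x * Real.exp (-(B * ∑ k ∈ Finset.range I.length, q ^ k)) * dist x y ≤
        dist (wordMap f I x) (wordMap f I y) ∧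
      dist (wordMap f I x) (wordMap f I y) ≤
        wordProd f N I x * Real.exp (B * ∑ k ∈ Finset.range I.length, q ^ k) * dist x y := by
    intro I x hx y hy
    induction I with
    | nil => simp [wordMap, wordProd]
    | cons i I ih =>
      have h1 := hdist i I.length _ (hmaps I hx) _ (hmaps I hy) (hsmall I x hx y hy)
      have h2 := hN i _ (hmaps I hx)
      rw [List.length_cons, Finset.sum_range_succ, mul_add, neg_add, Real.exp_add, Real.exp_add]
      constructor
      · refine le_trans ?_ h1.1
        refine le_trans (le_of_eq ?_) (mul_le_mul_of_nonneg_left ih.1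
          (mul_pos h2 (Real.exp_pos _)).le)
        simp only [wordProd]
        ring
      · refine h1.2.trans ((mul_le_mul_of_nonneg_left ih.2
          (mul_pos h2 (Real.exp_pos _)).le).trans (le_of_eq ?_))
        simp only [wordProd]
        ring
  -- After n letters distances have shrunk by `r ^ n`, so the distortion exponents are summed by a
  -- geometric series.
  set e := Real.exp (B * (1 - q)⁻¹) with he
  have he0 : 0 < e := Real.exp_pos _
  have he1 : 1 ≤ e := Real.one_le_exp (mul_nonneg hB (inv_nonneg.2 (by linarith)))
  have hgeom : ∀ n, B * ∑ k ∈ Finset.range n, q ^ k ≤ B * (1 - q)⁻¹ := fun n =>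
    mul_le_mul_of_nonneg_left (by
      rw [← tsum_geometric_of_lt_one hq0 hq1]
      exact (summable_geometric_of_lt_one hq0 hq1).sum_le_tsum _
        (fun _ _ => pow_nonneg hq0 _)) hB
  have hlow : ∀ I, ∀ x ∈ X, ∀ y ∈ X,
      wordProd f N I x * dist x y ≤ e * dist (wordMap f I x) (wordMap f I y) := by
    intro I x hx y hy
    have h1 : (1 : ℝ) ≤ e * Real.exp (-(B * ∑ k ∈ Finset.range I.length, q ^ k)) := by
      rw [he, ← Real.exp_add]
      exact Real.one_le_exp (by linarith [hgeom I.length])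
    have h2 := mul_nonneg (hG I x hx).le (dist_nonneg (x := x) (y := y))
    calc _ ≤ (e * Real.exp (-(B * ∑ k ∈ Finset.range I.length, q ^ k))) *
          (wordProd f N I x * dist x y) := le_mul_of_one_le_left h2 h1
      _ = e * (wordProd f N I x * Real.exp (-(B * ∑ k ∈ Finset.range I.length, q ^ k)) *
          dist x y) := by ring
      _ ≤ _ := mul_le_mul_of_nonneg_left (hword I x hx y hy).1 he0.le
  have hupp : ∀ I, ∀ x ∈ X, ∀ y ∈ X,
      dist (wordMap f I x) (wordMap f I y) ≤ e * (wordProd f N I x * dist x y) := by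
    intro I x hx y hy
    have h2 := mul_nonneg (hG I x hx).le (dist_nonneg (x := x) (y := y))
    calc _ ≤ _ := (hword I x hx y hy).2
      _ = Real.exp (B * ∑ k ∈ Finset.range I.length, q ^ k) *
          (wordProd f N I x * dist x y) := by ring
      _ ≤ _ := mul_le_mul_of_nonneg_right (Real.exp_le_exp.2 (hgeom _)) h2
  -- The image distance is symmetric in x and y, so the lower bound based at x can be played against
  -- the upper bound based at y.
  have hcomp : ∀ I, ∀ x ∈ X, ∀ y ∈ X, wordProd f N I x ≤ e ^ 2 * wordProd f N I y := by
    intro I x hx y hy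
    rcases eq_or_ne x y with rfl | hne
    · exact le_mul_of_one_le_left (hG I x hx).le (one_le_pow₀ he1)
    · refine le_of_mul_le_mul_right ?_ (dist_pos.2 hne)
      have h1 := hupp I y hy x hx
      rw [dist_comm (wordMap f I y), dist_comm y] at h1
      calc _ ≤ e * dist (wordMap f I x) (wordMap f I y) := hlow I x hx y hy
        _ ≤ e * (e * (wordProd f N I y * dist x y)) := by gcongr
        _ = _ := by ring
  obtain ⟨x₀, hx₀⟩ := hXn.nonempty
  refine ⟨fun I => wordProd f N I x₀, e ^ 3, hXn, hXc, hXeq, hsep, one_le_pow₀ he1,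
    fun I => hG I x₀ hx₀, hr0, hr1, hcontr, fun I x hx y hy => ?_, fun I x hx y hy => ?_⟩
  · calc wordProd f N I x₀ * dist x y ≤ e ^ 2 * wordProd f N I x * dist x y := by
          gcongr
          exact hcomp I x₀ hx₀ x hx
      _ = e ^ 2 * (wordProd f N I x * dist x y) := by ring
      _ ≤ e ^ 2 * (e * dist (wordMap f I x) (wordMap f I y)) :=
          mul_le_mul_of_nonneg_left (hlow I x hx y hy) (by positivity)
      _ = _ := by ring
  · calc _ ≤ e * (wordProd f N I x * dist x y) := hupp I x hx y hy
      _ ≤ e * (e ^ 2 * wordProd f N I x₀ * dist x y) := by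
          gcongr
          exact hcomp I x hx x₀ hx₀
      _ = _ := by ring

end Distortion

/-! ### Distortion of conformal contractions -/

section Conformal

/-- Absorbs bounded factors for pairs of points that are not close, where the mean value inequality
is unavailable because V need not be convex. -/
lemma exists_le_exp_mul (m : ℝ) {β : ℝ} (hβ : 0 < β) : ∃ C : ℝ, 0 ≤ C ∧ m ≤ Real.exp (C * β) := by
  refine ⟨|m| / β, by positivity, ?_⟩
  rw [div_mul_cancel₀ _ hβ.ne']
  linarith [Real.add_one_le_exp |m|, le_abs_self m]

variable {d : ℕ} {ψ : EuclideanSpace ℝ (Fin d) → EuclideanSpace ℝ (Fin d)}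
  {V Y : Set (EuclideanSpace ℝ (Fin d))}

lemma norm_fderiv_le_mul_exp {a c α : ℝ} (ha : 0 < a) (hα : ∀ x ∈ V, a ≤ ‖fderiv ℝ ψ x‖)
    (hc : 0 ≤ c)
    (hh : ∀ x ∈ V, ∀ y ∈ V, |‖fderiv ℝ ψ x‖ - ‖fderiv ℝ ψ y‖| ≤ c * ‖x - y‖ ^ α)
    {x y : EuclideanSpace ℝ (Fin d)} (hx : x ∈ V) (hy : y ∈ V) :
    ‖fderiv ℝ ψ x‖ ≤ ‖fderiv ℝ ψ y‖ * Real.exp (c / a * ‖x - y‖ ^ α) := by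
  have h1 := (abs_le.1 (hh x hx y hy)).2
  have h2 := hα y hy
  have h3 : 0 ≤ c / a * ‖x - y‖ ^ α := by positivity
  calc ‖fderiv ℝ ψ x‖ ≤ ‖fderiv ℝ ψ y‖ + a * (c / a * ‖x - y‖ ^ α) := by
        have : a * (c / a * ‖x - y‖ ^ α) = c * ‖x - y‖ ^ α := by field_simp
        linarith
    _ ≤ ‖fderiv ℝ ψ y‖ + ‖fderiv ℝ ψ y‖ * (c / a * ‖x - y‖ ^ α) := by gcongr
    _ = ‖fderiv ℝ ψ y‖ * (c / a * ‖x - y‖ ^ α + 1) := by ring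
    _ ≤ _ := by
        gcongr
        exact Real.add_one_le_exp _

lemma IsConformalOn.hasStrictFDerivAt (h : IsConformalOn ψ V) (hV : IsOpen V)
    {x : EuclideanSpace ℝ (Fin d)} (hx : x ∈ V) : HasStrictFDerivAt ψ (fderiv ℝ ψ x) x :=
  (h.contDiffOn.contDiffAt (hV.mem_nhds hx)).hasStrictFDerivAt one_ne_zero

lemma IsConformalOn.exists_equiv (h : IsConformalOn ψ V) (hV : IsOpen V)
    {x : EuclideanSpace ℝ (Fin d)} (hx : x ∈ V) (hpos : 0 < ‖fderiv ℝ ψ x‖) :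
    ∃ A : EuclideanSpace ℝ (Fin d) ≃L[ℝ] EuclideanSpace ℝ (Fin d),
      HasStrictFDerivAt ψ (A : EuclideanSpace ℝ (Fin d) →L[ℝ] EuclideanSpace ℝ (Fin d)) x ∧
      ‖(A.symm : EuclideanSpace ℝ (Fin d) →L[ℝ] EuclideanSpace ℝ (Fin d))‖ ≤
        ‖fderiv ℝ ψ x‖⁻¹ := by
  have hinj : Function.Injective (fderiv ℝ ψ x).toLinearMap := by
    rw [injective_iff_map_eq_zero]
    intro y hy
    have hy' : fderiv ℝ ψ x y = 0 := hy
    have h1 := h.norm_fderiv_apply x hx y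
    rw [hy', norm_zero] at h1
    rcases mul_eq_zero.1 h1.symm with h2 | h2
    · exact absurd h2 hpos.ne'
    · exact norm_eq_zero.1 h2
  let A := (LinearEquiv.ofInjectiveEndo _ hinj).toContinuousLinearEquiv
  have hA : ∀ y, A y = fderiv ℝ ψ x y := fun y => rfl
  refine ⟨A, ?_, ?_⟩
  · have : (A : EuclideanSpace ℝ (Fin d) →L[ℝ] EuclideanSpace ℝ (Fin d)) = fderiv ℝ ψ x :=
      ContinuousLinearMap.ext hA
    rw [this]
    exact h.hasStrictFDerivAt hV hx
  · refine ContinuousLinearMap.opNorm_le_bound _ (inv_nonneg.2 hpos.le) fun y => ?_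
    have h1 := h.norm_fderiv_apply x hx (A.symm y)
    rw [← hA, A.apply_symm_apply] at h1
    rw [h1, inv_mul_cancel_left₀ hpos.ne']
    rfl

/-- Close points lie in a ball inside V, where the mean value inequality and the Hölder bound apply.
For distant points the contraction bound suffices once the exponential exceeds `1 / a`. -/
lemma IsConformalContractionOn.dist_le (h : IsConformalContractionOn ψ V) (hV : IsOpen V)
    (hY : IsCompact Y) (hYV : Y ⊆ V) {α c a : ℝ} (hα0 : 0 < α) (hc : 0 ≤ c) (ha : 0 < a)
    (hlow : ∀ x ∈ V, a ≤ ‖fderiv ℝ ψ x‖)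
    (hh : ∀ x ∈ V, ∀ y ∈ V, |‖fderiv ℝ ψ x‖ - ‖fderiv ℝ ψ y‖| ≤ c * ‖x - y‖ ^ α) :
    ∃ C : ℝ, 0 ≤ C ∧ ∀ x ∈ Y, ∀ y ∈ Y,
      dist (ψ x) (ψ y) ≤ ‖fderiv ℝ ψ x‖ * Real.exp (C * dist x y ^ α) * dist x y := by
  obtain ⟨δ, hδ, hthick⟩ := hY.exists_thickening_subset_open hV hYV
  have hδα : 0 < δ ^ α := Real.rpow_pos_of_pos hδ α
  obtain ⟨C₁, hC₁, hexp⟩ := exists_le_exp_mul (1 / a) hδα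
  refine ⟨max (c / a) C₁, le_max_of_le_right hC₁, fun x hx y hy => ?_⟩
  have hxa := hlow x (hYV hx)
  rcases lt_or_ge (dist x y) δ with hlt | hge
  · have hsub : closedBall x (dist x y) ⊆ V := fun w hw =>
      hthick (mem_thickening_iff.2 ⟨x, hx, (mem_closedBall.1 hw).trans_lt hlt⟩)
    have key := Convex.norm_image_sub_le_of_norm_fderiv_le (𝕜 := ℝ) (f := ψ)
      (s := closedBall x (dist x y)) (C := ‖fderiv ℝ ψ x‖ * Real.exp (c / a * dist x y ^ α))
      (fun w hw => (h.conformal.hasStrictFDerivAt hV (hsub hw)).hasFDerivAt.differentiableAt)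
      (fun w hw => (norm_fderiv_le_mul_exp ha hlow hc hh (hsub hw) (hYV hx)).trans (by
        rw [← dist_eq_norm]
        gcongr
        exact mem_closedBall.1 hw))
      (convex_closedBall _ _) (mem_closedBall_self dist_nonneg)
      (mem_closedBall.2 (dist_comm y x).le)
    rw [← dist_eq_norm, ← dist_eq_norm, dist_comm, dist_comm y] at key
    refine key.trans ?_
    gcongr
    exact le_max_left _ _
  · obtain ⟨r, hr, hcon⟩ := h.contraction
    have h1 := hcon x (hYV hx) y (hYV hy)
    have h2 : 1 ≤ a * Real.exp (max (c / a) C₁ * dist x y ^ α) := by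
      have : 1 / a ≤ Real.exp (max (c / a) C₁ * dist x y ^ α) := by
        refine hexp.trans (Real.exp_le_exp.2 ?_)
        gcongr
        exact le_max_right _ _
      rwa [div_le_iff₀ ha, mul_comm] at this
    calc dist (ψ x) (ψ y) ≤ 1 * dist x y := h1.trans (by gcongr; exact hr.2.le)
      _ ≤ a * Real.exp (max (c / a) C₁ * dist x y ^ α) * dist x y := by gcongr
      _ ≤ _ := by gcongr

/-- The mean value inequality is applied to the inverse of ψ on balls inside the open set `ψ '' V`;
by conformality, the derivative of the inverse has norm at most the reciprocal of that of ψ. -/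
lemma IsConformalContractionOn.le_dist (h : IsConformalContractionOn ψ V) (hV : IsOpen V)
    (hY : IsCompact Y) (hYV : Y ⊆ V) {α c a : ℝ} (hα0 : 0 < α) (hc : 0 ≤ c) (ha : 0 < a)
    (hlow : ∀ x ∈ V, a ≤ ‖fderiv ℝ ψ x‖)
    (hh : ∀ x ∈ V, ∀ y ∈ V, |‖fderiv ℝ ψ x‖ - ‖fderiv ℝ ψ y‖| ≤ c * ‖x - y‖ ^ α) :
    ∃ C : ℝ, 0 ≤ C ∧ ∀ x ∈ Y, ∀ y ∈ Y,
      ‖fderiv ℝ ψ x‖ * Real.exp (-(C * dist x y ^ α)) * dist x y ≤ dist (ψ x) (ψ y) := by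
  let g := Function.invFunOn ψ V
  have hg : ∀ x ∈ V, g (ψ x) = x := fun x hx => h.injOn.leftInvOn_invFunOn hx
  have hpos : ∀ x ∈ V, 0 < ‖fderiv ℝ ψ x‖ := fun x hx => ha.trans_le (hlow x hx)
  have hopen : IsOpen (ψ '' V) := by
    rw [isOpen_iff_mem_nhds]
    rintro _ ⟨x, hx, rfl⟩
    obtain ⟨A, hA, _⟩ := h.conformal.exists_equiv hV hx (hpos x hx)
    rw [← hA.map_nhds_eq_of_equiv]
    exact image_mem_map (hV.mem_nhds hx)
  have hgd : ∀ x ∈ V, ∃ A' : EuclideanSpace ℝ (Fin d) →L[ℝ] EuclideanSpace ℝ (Fin d),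
      HasFDerivAt g A' (ψ x) ∧ ‖A'‖ ≤ ‖fderiv ℝ ψ x‖⁻¹ := by
    intro x hx
    obtain ⟨A, hA, hAn⟩ := h.conformal.exists_equiv hV hx (hpos x hx)
    refine ⟨_, (hA.to_local_left_inverse ?_).hasFDerivAt, hAn⟩
    filter_upwards [hV.mem_nhds hx] with w hw using hg w hw
  have hcont : ContinuousOn ψ Y := fun x hx =>
    (h.conformal.hasStrictFDerivAt hV (hYV hx)).hasFDerivAt.continuousAt.continuousWithinAt
  obtain ⟨ρ, hρ, hthick⟩ := (hY.image_of_continuousOn hcont).exists_thickening_subset_open hopen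
    (image_mono hYV)
  have hρα : 0 < ρ ^ α := Real.rpow_pos_of_pos hρ α
  obtain ⟨C₁, hC₁, hexp⟩ := exists_le_exp_mul (diam Y / ρ) hρα
  obtain ⟨b, hb1, hb⟩ := h.upper_bound
  obtain ⟨r, hr, hcon⟩ := h.contraction
  refine ⟨max (c / a * (1 / a) ^ α) C₁, le_max_of_le_right hC₁, fun x hx y hy => ?_⟩
  have hxV := hYV hx
  have hyV := hYV hy
  have hψle : dist (ψ x) (ψ y) ≤ dist x y :=
    (hcon x hxV y hyV).trans (mul_le_of_le_one_left dist_nonneg hr.2.le)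
  suffices H : ‖fderiv ℝ ψ x‖ * dist x y ≤
      Real.exp (max (c / a * (1 / a) ^ α) C₁ * dist x y ^ α) * dist (ψ x) (ψ y) by
    rw [Real.exp_neg, mul_right_comm, ← div_eq_mul_inv, div_le_iff₀ (Real.exp_pos _),
      mul_comm _ (Real.exp _)]
    exact H
  rcases lt_or_ge (dist (ψ x) (ψ y)) ρ with hlt | hge
  · set R := dist (ψ x) (ψ y) with hR
    have hsub : closedBall (ψ x) R ⊆ ψ '' V := fun w hw =>
      hthick (mem_thickening_iff.2
        ⟨ψ x, mem_image_of_mem _ hx, (mem_closedBall.1 hw).trans_lt hlt⟩)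
    have hxR : ψ x ∈ closedBall (ψ x) R := mem_closedBall_self dist_nonneg
    have hmvt : ∀ M : ℝ, (∀ w ∈ V, ψ w ∈ closedBall (ψ x) R → ‖fderiv ℝ ψ w‖⁻¹ ≤ M) →
        ∀ u ∈ V, ψ u ∈ closedBall (ψ x) R → dist u x ≤ M * dist (ψ u) (ψ x) := by
      intro M hM u hu huR
      have := Convex.norm_image_sub_le_of_norm_fderiv_le (𝕜 := ℝ) (f := g)
        (s := closedBall (ψ x) R) (C := M)
        (fun w hw => by
          obtain ⟨v, hv, rfl⟩ := hsub hw
          obtain ⟨A', hA', _⟩ := hgd v hv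
          exact hA'.differentiableAt)
        (fun w hw => by
          obtain ⟨v, hv, rfl⟩ := hsub hw
          obtain ⟨A', hA', hn⟩ := hgd v hv
          rw [hA'.fderiv]
          exact hn.trans (hM v hv hw))
        (convex_closedBall _ _) hxR huR
      rwa [← dist_eq_norm, ← dist_eq_norm, hg u hu, hg x hxV] at this
    -- A first, crude use of the mean value bound keeps preimages of the ball near x, so that the
    -- Hölder estimate can be fed into a second, sharp use. This is the origin of `(1 / a) ^ α`.
    have hfar : ∀ w ∈ V, ψ w ∈ closedBall (ψ x) R → dist x w ≤ 1 / a * dist x y := by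
      intro w hw hwR
      rw [dist_comm]
      refine (hmvt (1 / a) (fun v hv _ => ?_) w hw hwR).trans ?_
      · rw [one_div]
        exact inv_anti₀ ha (hlow v hv)
      · gcongr
        exact (mem_closedBall.1 hwR).trans hψle
    have hyR : ψ y ∈ closedBall (ψ x) R := mem_closedBall.2 (dist_comm _ _).le
    have key := hmvt (Real.exp (c / a * (1 / a) ^ α * dist x y ^ α) * ‖fderiv ℝ ψ x‖⁻¹)
      (fun w hw hwR => by
        have h1 := norm_fderiv_le_mul_exp ha hlow hc hh hxV hw
        have h2 : ‖fderiv ℝ ψ x‖ ≤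
            ‖fderiv ℝ ψ w‖ * Real.exp (c / a * (1 / a) ^ α * dist x y ^ α) := by
          refine h1.trans ?_
          rw [mul_assoc (c / a), ← Real.mul_rpow (by positivity) dist_nonneg, ← dist_eq_norm]
          gcongr
          exact hfar w hw hwR
        rw [← div_eq_mul_inv, inv_eq_one_div, div_le_div_iff₀ (hpos w hw) (hpos x hxV)]
        linarith) y hyV hyR
    rw [dist_comm y, dist_comm (ψ y)] at key
    calc ‖fderiv ℝ ψ x‖ * dist x y ≤ ‖fderiv ℝ ψ x‖ *
          (Real.exp (c / a * (1 / a) ^ α * dist x y ^ α) * ‖fderiv ℝ ψ x‖⁻¹ *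
            dist (ψ x) (ψ y)) := by gcongr
      _ = Real.exp (c / a * (1 / a) ^ α * dist x y ^ α) * dist (ψ x) (ψ y) := by
          have := (hpos x hxV).ne'
          field_simp
      _ ≤ _ := by
          gcongr
          exact le_max_left _ _
  · have h1 : dist x y ≤ diam Y := dist_le_diam_of_mem hY.isBounded hx hy
    have h2 : diam Y / ρ ≤ Real.exp (max (c / a * (1 / a) ^ α) C₁ * dist x y ^ α) := by
      refine hexp.trans (Real.exp_le_exp.2 ?_)
      have := hge.trans hψle
      gcongr
      exact le_max_right _ _
    rw [div_le_iff₀ hρ] at h2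
    calc ‖fderiv ℝ ψ x‖ * dist x y ≤ 1 * diam Y := by
          gcongr
          exact (hb x hxV).trans hb1.le
      _ ≤ Real.exp (max (c / a * (1 / a) ^ α) C₁ * dist x y ^ α) * ρ := by rwa [one_mul]
      _ ≤ _ := by gcongr

/-- A conformal contraction is a similarity on `Y` up to a Hölder error in the exponent, which
decays geometrically when the distances do. -/
lemma IsConformalContractionOn.exists_distortion (h : IsConformalContractionOn ψ V)
    (hV : IsOpen V) (hY : IsCompact Y) (hYV : Y ⊆ V) {r D : ℝ} (hr0 : 0 < r) (hr1 : r < 1)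
    (hD : 0 ≤ D) :
    ∃ B q : ℝ, 0 ≤ B ∧ 0 ≤ q ∧ q < 1 ∧ ∀ k : ℕ, ∀ x ∈ Y, ∀ y ∈ Y, dist x y ≤ r ^ k * D →
      ‖fderiv ℝ ψ x‖ * Real.exp (-(B * q ^ k)) * dist x y ≤ dist (ψ x) (ψ y) ∧
      dist (ψ x) (ψ y) ≤ ‖fderiv ℝ ψ x‖ * Real.exp (B * q ^ k) * dist x y := by
  obtain ⟨α, hα, c, hc, hh⟩ := h.holder
  obtain ⟨a, ha, hlow⟩ := h.lower_bound
  obtain ⟨C₁, hC₁, h₁⟩ := h.dist_le hV hY hYV hα hc.le ha hlow hh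
  obtain ⟨C₂, hC₂, h₂⟩ := h.le_dist hV hY hYV hα hc.le ha hlow hh
  have hDα : 0 ≤ D ^ α := Real.rpow_nonneg hD α
  refine ⟨max C₁ C₂ * D ^ α, r ^ α, mul_nonneg (le_max_of_le_left hC₁) hDα,
    Real.rpow_nonneg hr0.le α, Real.rpow_lt_one hr0.le hr1 hα, fun k x hx y hy hxy => ?_⟩
  have hexp : dist x y ^ α ≤ D ^ α * (r ^ α) ^ k := by
    calc dist x y ^ α ≤ (r ^ k * D) ^ α := by gcongr
      _ = _ := by
        rw [Real.mul_rpow (by positivity) hD, ← Real.rpow_natCast, ← Real.rpow_natCast,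
          ← Real.rpow_mul hr0.le, ← Real.rpow_mul hr0.le, mul_comm (k : ℝ), mul_comm]
  have hmax : ∀ C ≤ max C₁ C₂, C * dist x y ^ α ≤ max C₁ C₂ * D ^ α * (r ^ α) ^ k := by
    intro C hC
    rw [mul_assoc]
    exact mul_le_mul hC hexp (Real.rpow_nonneg dist_nonneg α) (le_max_of_le_left hC₁)
  constructor
  · refine le_trans ?_ (h₂ x hx y hy)
    have := hmax C₂ (le_max_right _ _)
    refine mul_le_mul_of_nonneg_right (mul_le_mul_of_nonneg_left ?_ (norm_nonneg _)) dist_nonneg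
    exact Real.exp_le_exp.2 (neg_le_neg this)
  · refine (h₁ x hx y hy).trans ?_
    have := hmax C₁ (le_max_left _ _)
    refine mul_le_mul_of_nonneg_right (mul_le_mul_of_nonneg_left ?_ (norm_nonneg _)) dist_nonneg
    exact Real.exp_le_exp.2 this

/-- The attractor of a conformal system with strong separation is quasi self-similar. -/
theorem IsConformalIFS.exists_isQuasiSelfSimilar {ι : Type*} [Finite ι] [Nontrivial ι]
    {φ : ι → EuclideanSpace ℝ (Fin d) → EuclideanSpace ℝ (Fin d)}
    {X : Set (EuclideanSpace ℝ (Fin d))} (hφ : IsConformalIFS φ Y) (hX : IsAttractor φ Y X)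
    (hsep : StrongSeparation φ X) : ∃ ℓ K r, IsQuasiSelfSimilar φ X ℓ K r := by
  obtain ⟨x₀, hx₀⟩ := hX.nonempty
  have hmaps : ∀ i, MapsTo (φ i) X X := fun i x hx => by
    rw [hX.eq_iUnion]
    exact mem_iUnion.2 ⟨i, mem_image_of_mem _ hx⟩
  have hXn : X.Nontrivial := by
    obtain ⟨i, j, hij⟩ := exists_pair_ne ι
    refine ⟨φ i x₀, hmaps i hx₀, φ j x₀, hmaps j hx₀, fun heq => ?_⟩
    exact disjoint_left.1 (hsep i j hij) (mem_image_of_mem _ hx₀) ⟨x₀, hx₀, heq.symm⟩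
  choose ρ hρ hcon using hφ.isIFS.contraction
  obtain ⟨i₀, hi₀⟩ := Finite.exists_max ρ
  choose V hVo _ hYV ψ hψ hconf using hφ.extension
  choose B q hB hq0 hq1 hdist using fun i => (hconf i).exists_distortion (hVo i) hφ.isCompact
    (hYV i) (hρ i₀).1 (hρ i₀).2 (diam_nonneg (s := X))
  -- Finitely many maps: the worst `B` and the worst `q`, possibly of different maps, serve for all.
  obtain ⟨i₁, hi₁⟩ := Finite.exists_max B
  obtain ⟨i₂, hi₂⟩ := Finite.exists_max q
  obtain ⟨ℓ, K, h⟩ := isQuasiSelfSimilar_of_distortion (f := φ) hXn hX.isCompact hX.eq_iUnion hsep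
    (hρ i₀).1 (hρ i₀).2
    (fun i x hx y hy => (hcon i x (hX.subset hx) y (hX.subset hy)).trans
      (mul_le_mul_of_nonneg_right (hi₀ i) dist_nonneg))
    (N := fun i x => ‖fderiv ℝ (ψ i) x‖)
    (fun i x hx => by
      obtain ⟨a, ha, hlow⟩ := (hconf i).lower_bound
      exact ha.trans_le (hlow x (hYV i (hX.subset hx))))
    (hB i₁) (hq0 i₂) (hq1 i₂)
    (fun i k x hx y hy hxy => by
      have h1 := hdist i k x (hX.subset hx) y (hX.subset hy) hxy
      rw [hψ i (hX.subset hx), hψ i (hX.subset hy)] at h1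
      have h2 : B i * q i ^ k ≤ B i₁ * q i₂ ^ k :=
        mul_le_mul (hi₁ i) (pow_le_pow_left₀ (hq0 i) (hi₂ i) k) (pow_nonneg (hq0 i) k) (hB i₁)
      constructor
      · refine le_trans ?_ h1.1
        gcongr
      · refine h1.2.trans ?_
        gcongr)
  exact ⟨ℓ, K, _, h⟩

end Conformal

end SelfConformal

open SelfConformal
theorem mainTheorem3 {d : ℕ} {ι : Type*} [Finite ι] [Nontrivial ι]
    (φ : ι → EuclideanSpace ℝ (Fin d) → EuclideanSpace ℝ (Fin d))
    (Y X : Set (EuclideanSpace ℝ (Fin d)))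
    (hφ : IsConformalIFS φ Y) (hX : IsAttractor φ Y X) (hsep : StrongSeparation φ X)
    (z : EuclideanSpace ℝ (Fin d)) (hz : z ∈ X)
    (θ : ℕ → ℝ≥0)
    (hθ : AsympOn {n : ℕ | 1 ≤ n} (fun n => (θ n : ℝ))
      (fun n => (n : ℝ) ^ (-(1 / (dimH X).toReal)))) :
    ∀ᵐ x ∂((Measure.hausdorffMeasure (dimH X).toReal).restrict X), x ∈ W φ X θ z := by
  obtain ⟨ℓ, K, r, h⟩ := hφ.exists_isQuasiSelfSimilar hX hsep
  have hdim : dimH X ≠ ∞ := Real.dimH_ne_top X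
  have : Fintype ι := Fintype.ofFinite ι
  obtain ⟨C, _, hC⟩ := hθ
  exact h.ae_mem_W (h.dimH_pos hdim) (h.hausdorffMeasure_ne_top hdim) hz θ fun n hn => (hC n hn).2
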